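/- Let $K\ge 1$, let $\mathcal X_1,\dots,\mathcal X_K$ (input alphabets) and $\mathcal Y_1,\dots,\mathcal Y_K$ (output alphabets) be non-empty standard Borel spaces, and let $P_{Y_1\cdots Y_K\mid X_1\cdots X_K}$ be a memoryless channel, i.e. a Markov kernel from $\prod_i\mathcal X_i$ to $\prod_i\mathcal Y_i$, used without feedback. In the $K$-user cognitive interference channel with cumulative message sharing, a code of block length $N$ and non-negative rate tuple $(R_1,\dots,R_K)$ (in bits) consists of independent messages $W_i$, uniform on the set of integers $[1:2^{NR_i}]$; encoders $X_i^N=f_i^{(N)}(W_1,\dots,W_i)\in\mathcal X_i^N$; and measurable decoders $\widehat W_i=g_i^{(N)}(Y_i^N)\in[1:2^{NR_i}]$, for $i\in[1:K]$. Its error probability is $P_e^{(N)}=\max_i\mathbb P[\widehat W_i\ne W_i]$. The capacity region $\mathcal C$ is the set of non-negative tuples $(R_1,\dots,R_K)$ for which there is a sequence of such codes, indexed by $N$, with $P_e^{(N)}\to 0$ as $N\to\infty$. Let $\mathcal R$ be the set of non-negative tuples $(R_1,\dots,R_K)$ for which there is a probability distribution $P_{X_1\cdots X_K}$ on $\prod_i\mathcal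 X_i$ such that, for every channel $Q_{Y_1\cdots Y_K\mid X_1\cdots X_K}$ with the same conditional marginals, $Q_{Y_i\mid X_1\cdots X_K}=P_{Y_i\mid X_1\cdots X_K}$ for all $i\in[1:K]$, and for every $i\in[1:K]$, $$R_i\le I(Y_i;X_i,\dots,X_K\mid X_1,\dots,X_{i-1}),$$ $$\sum_{j=i}^K R_j\le\sum_{j=i}^K I(Y_j;X_j,\dots,X_K\mid X_1,\dots,X_{j-1},Y_i,\dots,Y_{j-1}),$$ where the mutual informations (in bits, with values in $[0,\infty]$) are computed for $(X_1,\dots,X_K)\sim P_{X_1\cdots X_K}$ and $(Y_1,\dots,Y_K)$ produced from it by $Q$. (So one input distribution serves all the bounds, and each bound may be tightened separately over the channels with the given conditional marginals.) Then $\mathcal C\subseteq\mathcal R$ if all input alphabets $\mathcal X_i$ are finite (the output alphabets being arbitrary), and $\mathcal C\subseteq\overline{\mathcal R}$, the closure in $\mathbb R^K$, for arbitrary alphabets. -/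

import Mathlib

open MeasureTheory ProbabilityTheory Filter Topology
open scoped ENNReal

noncomputable section

namespace CIFC

/-- Conditional mutual information `I(A; B | C)` in bits of random variables on `(Ω, μ)`:
the Kullback-Leibler divergence of `P_{C,A,B}` from `P_C ⊗ (P_{A|C} × P_{B|C})`,
converted from nats to bits. It takes values in `[0, ∞]`. -/
def condMutualInfo {Ω α β γ : Type*} [MeasurableSpace Ω]
    [MeasurableSpace α] [StandardBorelSpace α] [Nonempty α]
    [MeasurableSpace β] [StandardBorelSpace β] [Nonempty β] [MeasurableSpace γ]
    (μ : Measure Ω) [IsFiniteMeasure μ] (A : Ω → α) (B : Ω → β) (C : Ω → γ) : ℝ≥0∞ :=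
  InformationTheory.klDiv (μ.map fun ω => (C ω, A ω, B ω))
      (μ.map C ⊗ₘ (condDistrib A C μ ×ₖ condDistrib B C μ))
    / ENNReal.ofReal (Real.log 2)

variable {K : ℕ} {X Y : Fin K → Type*}

/-- A block code of length `N` with `M i` messages for user `i`. Encoder `i` knows the messages of
users `1, …, i` (cumulative message sharing); decoder `i` observes only its own output block. -/
structure Code (X Y : Fin K → Type*) [∀ i, MeasurableSpace (Y i)] (M : Fin K → ℕ) (N : ℕ) where
  /-- Encoding functions. -/
  enc : ∀ i : Fin K, (∀ j : Set.Iic i, Fin (M j)) → Fin N → X i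
  /-- Decoding functions. -/
  dec : ∀ i : Fin K, (Fin N → Y i) → Fin (M i)
  measurable_dec : ∀ i, Measurable (dec i)

variable [∀ i, MeasurableSpace (X i)] [∀ i, MeasurableSpace (Y i)]

namespace Code

variable {M : Fin K → ℕ} {N : ℕ}

/-- The channel input at time `t` when the message tuple is `w`. -/
def input (c : Code X Y M N) (w : ∀ i, Fin (M i)) (t : Fin N) : ∀ i, X i :=
  fun i => c.enc i (fun j => w j) t

/-- The law of the output block given the message tuple `w`: the channel is memoryless and is used
without feedback. -/
def outputLaw (c : Code X Y M N) (ch : Kernel (∀ i, X i) (∀ i, Y i)) (w : ∀ i, Fin (M i)) :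
    Measure (Fin N → ∀ i, Y i) :=
  Measure.pi fun t => ch (c.input w t)

/-- The probability that receiver `i` decodes its message incorrectly, when the messages are
independent and uniformly distributed. -/
def userErrorProb (c : Code X Y M N) (ch : Kernel (∀ i, X i) (∀ i, Y i)) (i : Fin K) : ℝ≥0∞ :=
  (∑ w : ∀ i, Fin (M i), c.outputLaw ch w {y | c.dec i (fun t => y t i) ≠ w i})
    / Fintype.card (∀ i, Fin (M i))

/-- The error probability of the code: the largest error probability of a receiver. -/
def errorProb (c : Code X Y M N) (ch : Kernel (∀ i, X i) (∀ i, Y i)) : ℝ≥0∞ :=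
  ⨆ i, c.userErrorProb ch i

end Code

/-- The number of messages in `[1 : 2 ^ (N r)]`. -/
def numMessages (N : ℕ) (r : ℝ) : ℕ := ⌊(2 : ℝ) ^ ((N : ℝ) * r)⌋₊

/-- The capacity region: the non-negative rate tuples for which there is a sequence of codes, indexed
by the block length, whose error probability tends to zero. -/
def capacityRegion (ch : Kernel (∀ i, X i) (∀ i, Y i)) : Set (Fin K → ℝ) :=
  {R | (∀ i, 0 ≤ R i) ∧
    ∃ c : ∀ N : ℕ, Code X Y (fun i => numMessages N (R i)) N,
      Tendsto (fun N => (c N).errorProb ch) atTop (𝓝 0)}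

/-- Two channels with the same conditional marginals `P_{Y_i | X_1, …, X_K}` for every `i`. -/
def SameMarginals (ch ch' : Kernel (∀ i, X i) (∀ i, Y i)) : Prop :=
  ∀ i, ch'.map (fun y => y i) = ch.map (fun y => y i)

section Bounds

variable [∀ i, StandardBorelSpace (X i)] [∀ i, Nonempty (X i)]
  [∀ i, StandardBorelSpace (Y i)] [∀ i, Nonempty (Y i)]

/-- `I(Y_i; X_i, …, X_K | X_1, …, X_{i-1})` for the input distribution `P` and the channel `ch`. -/
def singleBound (P : Measure (∀ i, X i)) [IsProbabilityMeasure P]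
    (ch : Kernel (∀ i, X i) (∀ i, Y i)) [IsMarkovKernel ch] (i : Fin K) : ℝ≥0∞ :=
  condMutualInfo (P ⊗ₘ ch)
    (fun z => z.2 i)
    (fun z (l : Set.Ici i) => z.1 l)
    (fun z (l : Set.Iio i) => z.1 l)

/-- `I(Y_j; X_j, …, X_K | X_1, …, X_{j-1}, Y_i, …, Y_{j-1})` for the input distribution `P` and the
channel `ch`. -/
def progressiveTerm (P : Measure (∀ i, X i)) [IsProbabilityMeasure P]
    (ch : Kernel (∀ i, X i) (∀ i, Y i)) [IsMarkovKernel ch] (i j : Fin K) : ℝ≥0∞ :=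
  condMutualInfo (P ⊗ₘ ch)
    (fun z => z.2 j)
    (fun z (l : Set.Ici j) => z.1 l)
    (fun z => ((fun l : Set.Iio j => z.1 l), (fun l : Set.Ico i j => z.2 l)))

/-- The outer bound region: one input distribution `P` has to satisfy all the bounds, each of them
for every channel with the same conditional marginals as `ch`. -/
def outerRegion (ch : Kernel (∀ i, X i) (∀ i, Y i)) : Set (Fin K → ℝ) :=
  {R | (∀ i, 0 ≤ R i) ∧
    ∃ (P : Measure (∀ i, X i)) (_ : IsProbabilityMeasure P),
      ∀ (ch' : Kernel (∀ i, X i) (∀ i, Y i)) (_ : IsMarkovKernel ch'), SameMarginals ch ch' →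
        (∀ i, ENNReal.ofReal (R i) ≤ singleBound P ch' i) ∧
        ∀ i, ENNReal.ofReal (∑ j ∈ Finset.Ici i, R j) ≤
          ∑ j ∈ Finset.Ici i, progressiveTerm P ch' i j}

end Bounds

end CIFC

end

/-! The proof is a change of measure, not a Fano-type chain of entropies. Fix a set `J` of
receivers, either `{i}` or `[i, K]`, and a channel with the given marginals. Each error event
involves a single output, so this channel may replace the original one (`Code.userErrorProb_congr`).
Compare the true output law with an auxiliary memoryless law that draws the outputs in `J` one after
the other, output `j` from its conditional law given the inputs before `j` and the earlier outputs
in `J` (`exists_causal_measure`). Under this law the outputs up to `j` carry no information about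
`W_j`. So receiver `j` can only guess, and all receivers in `J` succeed with average probability `1
/ ∏ M_j` (`Code.sum_pi_correct_mul`). Under the true law they succeed with probability close to one.

The log-likelihood ratio of the two laws is a sum over times and over `j ∈ J` of information
densities (`exists_information_density`), whose means are the mutual informations. A binary
hypothesis testing inequality (`log_mul_measureReal_le`) then bounds `∑ log M_j` by the mean of this
ratio, up to one bit and a factor tending to one (`Code.converse`). The same kernels serve at all
times, so the bound is single-letter at once.

For arbitrary alphabets, form the densities for the empirical input distribution of the code. It has
finite support, and the rates minus a vanishing back-off lie in the region, which gives the closure.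
For finite alphabets, pass to a limit `p` of the empirical distributions and form the densities at
`p` itself, so that no continuity of mutual information is needed. Inputs outside the support of `p`
are covered by mixing a small weight `δ` into the kernels (`IsCausalBound.exists_mixture`). The
bound is then linear in the input frequencies, and `N → ∞` followed by `δ → 0` finishes. -/

namespace CIFC

/-! ### Causal auxiliary output laws. -/

variable {K : ℕ} {X Y : Fin K → Type*} [∀ i, MeasurableSpace (Y i)]

/-- Integrating the likelihood ratio `exp (-ℓ x)` against the channel law at an input `x ∈ S`
amounts at most to resampling the output `j` from the kernel `q x`, which sees only the inputs
before `j` and the outputs in `J` before `j`. -/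
structure IsCausalBound [∀ i, MeasurableSpace (X i)] (ch : Kernel (∀ i, X i) (∀ i, Y i))
    (S : Set (∀ i, X i)) (J : Finset (Fin K)) (j : Fin K) (ℓ : (∀ i, X i) → (∀ i, Y i) → ℝ)
    (q : (∀ i, X i) → Kernel (∀ i, Y i) (Y j)) : Prop where
  measurable : ∀ x ∈ S, Measurable (ℓ x)
  dependsOn : ∀ x ∈ S, DependsOn (ℓ x) {l | l ∈ J ∧ l ≤ j}
  integrable : ∀ x ∈ S, Integrable (ℓ x) (ch x)
  markov : ∀ x, IsMarkovKernel (q x)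
  kernel_causal : DependsOn q {l | l < j}
  kernel_dependsOn : ∀ x, DependsOn (fun y => q x y) {l | l ∈ J ∧ l < j}
  lintegral_le : ∀ x ∈ S, ∀ F : (∀ i, Y i) → ℝ≥0∞, Measurable F →
    DependsOn F {l | l ∈ J ∧ l ≤ j} →
    ∫⁻ y, F y * ENNReal.ofReal (Real.exp (-ℓ x y)) ∂(ch x) ≤
      ∫⁻ y, ∫⁻ a, F (Function.update y j a) ∂(q x y) ∂(ch x)

/-- The kernel that replaces the coordinate `j` of its argument by a sample from `q`. -/
noncomputable def resample {j : Fin K} (q : Kernel (∀ i, Y i) (Y j)) :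
    Kernel (∀ i, Y i) (∀ i, Y i) :=
  (Kernel.id ×ₖ q).map fun p => Function.update p.1 j p.2

instance {j : Fin K} (q : Kernel (∀ i, Y i) (Y j)) [IsMarkovKernel q] :
    IsMarkovKernel (resample q) :=
  Kernel.IsMarkovKernel.map _ measurable_update'

lemma lintegral_resample {j : Fin K} (q : Kernel (∀ i, Y i) (Y j)) [IsMarkovKernel q]
    {F : (∀ i, Y i) → ℝ≥0∞} (hF : Measurable F) (y : ∀ i, Y i) :
    ∫⁻ z, F z ∂(resample q y) = ∫⁻ a, F (Function.update y j a) ∂(q y) := by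
  have hu : Measurable fun p : (∀ i, Y i) × Y j => Function.update p.1 j p.2 := measurable_update'
  rw [resample, Kernel.lintegral_map _ hu _ hF,
    Kernel.lintegral_prod _ _ _ (g := fun p => F (Function.update p.1 j p.2)) (hF.comp hu),
    Kernel.id_apply, lintegral_dirac' _ ?_]
  · exact (Measurable.lintegral_kernel_prod_right' (κ := Kernel.const _ (q y))
      (f := fun p : (∀ i, Y i) × Y j => F (Function.update p.1 j p.2)) (hF.comp hu))

lemma lintegral_bind_resample {j : Fin K} (q : Kernel (∀ i, Y i) (Y j)) [IsMarkovKernel q]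
    (μ : Measure (∀ i, Y i)) {F : (∀ i, Y i) → ℝ≥0∞} (hF : Measurable F) :
    ∫⁻ z, F z ∂(μ.bind (resample q)) =
      ∫⁻ y, ∫⁻ a, F (Function.update y j a) ∂(q y) ∂μ := by
  rw [Measure.lintegral_bind (Kernel.aemeasurable _) hF.aemeasurable]
  simp_rw [lintegral_resample q hF]

lemma measurable_lintegral_update {j : Fin K} (q : Kernel (∀ i, Y i) (Y j)) [IsMarkovKernel q]
    {F : (∀ i, Y i) → ℝ≥0∞} (hF : Measurable F) :
    Measurable fun y => ∫⁻ a, F (Function.update y j a) ∂(q y) := by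
  simp_rw [← lintegral_resample q hF]
  exact hF.lintegral_kernel

lemma dependsOn_lintegral_update {j : Fin K} {q : Kernel (∀ i, Y i) (Y j)}
    {F : (∀ i, Y i) → ℝ≥0∞} {s t : Set (Fin K)} (hF : DependsOn F s)
    (hq : DependsOn (fun y => q y) t) (hs : ∀ l ∈ s, l ≠ j → l ∈ t) :
    DependsOn (fun y => ∫⁻ a, F (Function.update y j a) ∂(q y)) t := by
  intro y y' h
  have h1 : q y = q y' := hq h
  simp only [h1]
  refine lintegral_congr fun a => hF fun l hl => ?_
  by_cases hlj : l = j
  · subst hlj; simp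
  · simp [Function.update_of_ne hlj, h l (hs l hl hlj)]

variable [∀ i, MeasurableSpace (X i)]

/-- The causal auxiliary output laws obtained by drawing the outputs in `J` one after the other
from the kernels `q j`. -/
theorem exists_causal_measure [∀ i, Nonempty (Y i)] {ch : Kernel (∀ i, X i) (∀ i, Y i)}
    [IsMarkovKernel ch] {S : Set (∀ i, X i)} {J : Finset (Fin K)}
    {ℓ : Fin K → (∀ i, X i) → (∀ i, Y i) → ℝ}
    {q : ∀ j, (∀ i, X i) → Kernel (∀ i, Y i) (Y j)}
    (h : ∀ j ∈ J, IsCausalBound ch S J j (ℓ j) (q j)) :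
    ∃ Q : (∀ i, X i) → Measure (∀ i, Y i), (∀ x, IsProbabilityMeasure (Q x)) ∧
      (∀ m : Fin K, ∀ x x', (∀ l < m, x l = x' l) → ∀ F : (∀ i, Y i) → ℝ≥0∞, Measurable F →
        DependsOn F (Set.Iic m) → ∫⁻ y, F y ∂(Q x) = ∫⁻ y, F y ∂(Q x')) ∧
      ∀ x ∈ S, ∀ F : (∀ i, Y i) → ℝ≥0∞, Measurable F → DependsOn F J →
        ∫⁻ y, F y * ENNReal.ofReal (Real.exp (-∑ j ∈ J, ℓ j x y)) ∂(ch x) ≤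
          ∫⁻ y, F y ∂(Q x) := by
  have key : ∀ n : ℕ, n ≤ K →
      ∃ Q : (∀ i, X i) → Measure (∀ i, Y i), (∀ x, IsProbabilityMeasure (Q x)) ∧
      (∀ m : Fin K, ∀ x x', (∀ l < m, x l = x' l) → ∀ F : (∀ i, Y i) → ℝ≥0∞, Measurable F →
        DependsOn F (Set.Iic m) → ∫⁻ y, F y ∂(Q x) = ∫⁻ y, F y ∂(Q x')) ∧
      ∀ x ∈ S, ∀ F : (∀ i, Y i) → ℝ≥0∞, Measurable F →
        DependsOn F {l | l ∈ J ∧ (l : ℕ) < n} →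
        ∫⁻ y, F y * ENNReal.ofReal (Real.exp (-∑ j ∈ J with j.val < n, ℓ j x y)) ∂(ch x) ≤
          ∫⁻ y, F y ∂(Q x) := by
    intro n
    induction n with
    | zero =>
      intro _
      have y₀ : ∀ i, Y i := fun i => Classical.arbitrary _
      -- Coordinates outside `J` keep the value `y₀` forever; the test functions never look at them.
      refine ⟨fun _ => Measure.dirac y₀, fun _ => inferInstance, fun _ _ _ _ _ _ _ => rfl, ?_⟩
      intro x _ F hF hdep
      have hc : ∀ y, F y = F y₀ := fun y => hdep (by simp)
      simp [hc]
    | succ n ih =>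
      intro hn
      obtain ⟨Q, hQp, hQc, hQi⟩ := ih (by omega)
      set j : Fin K := ⟨n, by omega⟩ with hj
      by_cases hjJ : j ∈ J
      · have hb := h j hjJ
        have := hb.markov
        refine ⟨fun x => (Q x).bind (resample (q j x)), fun x => ?_, ?_, ?_⟩
        · have := hQp x
          infer_instance
        · intro m x x' hxx F hF hdep
          simp only
          rw [lintegral_bind_resample _ _ hF, lintegral_bind_resample _ _ hF]
          -- Either the test function ignores the new coordinate `j`, or `j ≤ m` and the kernel sees
          -- only inputs on which `x` and `x'` agree.
          rcases lt_or_ge m j with hm | hm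
          · have hFu : ∀ y a, F (Function.update y j a) = F y := fun y a =>
              hdep fun l hl => Function.update_of_ne (ne_of_lt (lt_of_le_of_lt hl hm)) _ _
            simpa [hFu] using hQc m x x' hxx F hF hdep
          · have hqq : q j x = q j x' := hb.kernel_causal fun l hl => hxx l (lt_of_lt_of_le hl hm)
            rw [hqq]
            refine hQc m x x' hxx _ (measurable_lintegral_update _ hF) ?_
            refine dependsOn_lintegral_update hdep
              ((hb.kernel_dependsOn x').mono fun l hl => ?_) fun l hl _ => hl
            exact (hl.2.le.trans hm : l ≤ m)
        · intro x hx F hF hdep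
          have hfil : (J.filter fun l => l.val < n + 1) =
              insert j (J.filter fun l => l.val < n) := by
            ext l
            simp only [Finset.mem_filter, Finset.mem_insert, hj, Fin.ext_iff]
            constructor
            · rintro ⟨h1, h2⟩
              rcases Nat.lt_succ_iff_lt_or_eq.1 h2 with h3 | h3
              · exact Or.inr ⟨h1, h3⟩
              · exact Or.inl h3
            · rintro (h1 | ⟨h1, h2⟩)
              · have : l = j := Fin.ext h1
                exact ⟨this ▸ hjJ, by omega⟩
              · exact ⟨h1, by omega⟩
          -- The likelihood ratio of the earlier outputs. It ignores coordinate `j`, hence comes out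
          -- of the resampling integral, and the induction hypothesis applies to `F` with coordinate
          -- `j` integrated out.
          set G : (∀ i, Y i) → ℝ≥0∞ := fun y =>
            ENNReal.ofReal (Real.exp (-∑ l ∈ J with l.val < n, ℓ l x y)) with hG
          have hGm : Measurable G := by
            have : Measurable fun y => ∑ l ∈ J with l.val < n, ℓ l x y :=
              Finset.measurable_sum _ fun l hl =>
                (h l (Finset.mem_filter.1 hl).1).measurable x hx
            fun_prop
          have hGd : DependsOn G {l | l ∈ J ∧ (l : ℕ) < n} := by
            intro y y' hy
            have : ∑ l ∈ J with l.val < n, ℓ l x y = ∑ l ∈ J with l.val < n, ℓ l x y' := by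
              refine Finset.sum_congr rfl fun l hl => ?_
              rw [Finset.mem_filter] at hl
              refine (h l hl.1).dependsOn x hx fun k hk => hy k ⟨hk.1, ?_⟩
              exact lt_of_le_of_lt hk.2 hl.2
            simp [hG, this]
          have hGu : ∀ y a, G (Function.update y j a) = G y := fun y a =>
            hGd fun l hl => Function.update_of_ne (fun e => by
              have := hl.2; rw [e] at this; exact lt_irrefl _ this) _ _
          have hsub : {l : Fin K | l ∈ J ∧ (l : ℕ) < n + 1} ⊆ {l | l ∈ J ∧ l ≤ j} :=
            fun l hl => ⟨hl.1, Fin.le_def.2 (Nat.lt_succ_iff.1 hl.2)⟩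
          calc ∫⁻ y, F y * ENNReal.ofReal
                (Real.exp (-∑ l ∈ J with l.val < n + 1, ℓ l x y)) ∂(ch x)
              = ∫⁻ y, (F y * G y) * ENNReal.ofReal (Real.exp (-ℓ j x y)) ∂(ch x) := by
                refine lintegral_congr fun y => ?_
                rw [hfil, Finset.sum_insert (by simp [hj]), neg_add, Real.exp_add,
                  ENNReal.ofReal_mul (Real.exp_nonneg _), mul_assoc, mul_comm (G y)]
            _ ≤ ∫⁻ y, ∫⁻ a, F (Function.update y j a) * G (Function.update y j a) ∂(q j x y)
                  ∂(ch x) := by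
                refine hb.lintegral_le x hx _ (hF.mul hGm) fun y y' hy => ?_
                rw [hdep fun l hl => hy l (hsub hl),
                  hGd fun l hl => hy l (hsub ⟨hl.1, Nat.lt_succ_of_lt hl.2⟩)]
            _ = ∫⁻ y, (∫⁻ a, F (Function.update y j a) ∂(q j x y)) * G y ∂(ch x) := by
                refine lintegral_congr fun y => ?_
                simp_rw [hGu]
                exact lintegral_mul_const _ (hF.comp (measurable_update y))
            _ ≤ ∫⁻ y, ∫⁻ a, F (Function.update y j a) ∂(q j x y) ∂(Q x) := by
                refine hQi x hx _ (measurable_lintegral_update _ hF) ?_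
                refine dependsOn_lintegral_update hdep (hb.kernel_dependsOn x) fun l hl hlj => ?_
                exact ⟨hl.1, (lt_of_le_of_ne (show l ≤ j from (hsub hl).2) hlj : l < j)⟩
            _ = _ := (lintegral_bind_resample _ _ hF).symm
      · refine ⟨Q, hQp, hQc, fun x hx F hF hdep => ?_⟩
        have hiff : ∀ l ∈ J, ((l : ℕ) < n + 1 ↔ (l : ℕ) < n) := fun l hl => by
          have : (l : ℕ) ≠ n := fun e => hjJ (by rwa [show j = l from Fin.ext e.symm])
          omega
        rw [Finset.filter_congr hiff]
        exact hQi x hx F hF (hdep.mono fun l hl => ⟨hl.1, (hiff l hl.1).1 hl.2⟩)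
  obtain ⟨Q, h1, h2, h3⟩ := key K le_rfl
  refine ⟨Q, h1, h2, fun x hx F hF hdep => ?_⟩
  simpa using h3 x hx F hF (hdep.mono fun l hl => ⟨hl, l.2⟩)

end CIFC

/-! ### Product laws, and guessing under causal laws. -/

namespace CIFC

/-- A product density on a product of probability spaces is dominated by a product measure as soon
as this holds in every factor. -/
lemma setLIntegral_pi_prod_le {ι : Type*} [Fintype ι] {α β : ι → Type*}
    [∀ i, MeasurableSpace (α i)] [∀ i, MeasurableSpace (β i)]
    (μ : ∀ i, Measure (α i)) [∀ i, IsProbabilityMeasure (μ i)] (ν : ∀ i, Measure (β i))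
    {f : ∀ i, α i → ℝ≥0∞} (hf : ∀ i, Measurable (f i))
    {r : ∀ i, α i → β i} (hr : ∀ i, Measurable (r i))
    (h : ∀ i s, MeasurableSet s → ∫⁻ y in r i ⁻¹' s, f i y ∂(μ i) ≤ ν i s)
    {E : Set (∀ i, β i)} (hE : MeasurableSet E) :
    ∫⁻ y in (fun y i => r i (y i)) ⁻¹' E, ∏ i, f i (y i) ∂(Measure.pi μ) ≤ Measure.pi ν E := by
  have hrm : Measurable fun (y : ∀ i, α i) i => r i (y i) :=
    measurable_pi_lambda _ fun i => (hr i).comp (measurable_pi_apply i)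
  set n : Measure (∀ i, β i) :=
    ((Measure.pi μ).withDensity fun y => ∏ i, f i (y i)).map fun y i => r i (y i) with hn
  have hnE : n E = ∫⁻ y in (fun y i => r i (y i)) ⁻¹' E, ∏ i, f i (y i) ∂(Measure.pi μ) := by
    rw [hn, Measure.map_apply hrm hE, withDensity_apply _ (hrm hE)]
  -- `OuterMeasure.pi` is the largest outer measure dominated on boxes by the product of the masses,
  -- so only boxes matter.
  have hle : n.toOuterMeasure ≤ OuterMeasure.pi fun i => (ν i).toOuterMeasure := by
    rw [OuterMeasure.le_pi]
    intro s _
    set s' : ∀ i, Set (β i) := fun i => toMeasurable (ν i) (s i)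
    have hs' : ∀ i, MeasurableSet (s' i) := fun i => measurableSet_toMeasurable _ _
    have hbox : MeasurableSet (Set.univ.pi s') := MeasurableSet.univ_pi hs'
    calc n (Set.univ.pi s) ≤ n (Set.univ.pi s') :=
          measure_mono (Set.pi_mono fun i _ => subset_toMeasurable _ _)
      _ = ∫⁻ y, ∏ i, (r i ⁻¹' s' i).indicator (f i) (y i) ∂(Measure.pi μ) := by
          rw [hn, Measure.map_apply hrm hbox, withDensity_apply _ (hrm hbox),
            ← lintegral_indicator (hrm hbox)]
          refine lintegral_congr fun y => ?_
          by_cases hy : ∀ i, r i (y i) ∈ s' i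
          · rw [Set.indicator_of_mem (by simpa [Set.mem_pi] using hy)]
            exact Finset.prod_congr rfl fun i _ =>
              (Set.indicator_of_mem (s := r i ⁻¹' s' i) (hy i) (f i)).symm
          · rw [Set.indicator_of_notMem (by simpa [Set.mem_pi] using hy)]
            obtain ⟨i, hi⟩ := not_forall.1 hy
            exact (Finset.prod_eq_zero (Finset.mem_univ i) 
              (Set.indicator_of_notMem (s := r i ⁻¹' s' i) hi (f i))).symm
      _ = ∏ i, ∫⁻ y, (r i ⁻¹' s' i).indicator (f i) y ∂(μ i) := by
          have hm : ∀ i, Measurable ((r i ⁻¹' s' i).indicator (f i)) := fun i =>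
            (hf i).indicator (hr i (hs' i))
          rw [lintegral_prod_eq_prod_lintegral_of_indepFun Finset.univ
            (fun i (y : ∀ i, α i) => (r i ⁻¹' s' i).indicator (f i) (y i))
            (iIndepFun_pi fun i => (hm i).aemeasurable)
            fun i => (hm i).comp (measurable_pi_apply i)]
          refine Finset.prod_congr rfl fun i _ => ?_
          exact (measurePreserving_eval μ i).lintegral_comp (hm i)
      _ ≤ ∏ i, ν i (s i) := by
          refine Finset.prod_le_prod' fun i _ => ?_
          rw [lintegral_indicator (hr i (hs' i))]
          exact (h i _ (hs' i)).trans_eq (measure_toMeasurable _)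
  rw [← hnE, Measure.pi, toMeasure_apply _ _ hE]
  exact hle E

section Mask

variable {K : ℕ} {Y : Fin K → Type*}

open scoped Classical in
/-- Overwrite the coordinates outside `s` by those of `y₀`. -/
noncomputable def mask (y₀ : ∀ i, Y i) (s : Set (Fin K)) (y : ∀ i, Y i) : ∀ i, Y i :=
  s.piecewise y y₀

lemma mask_apply_of_mem (y₀ y : ∀ i, Y i) {s : Set (Fin K)} {l : Fin K} (hl : l ∈ s) :
    mask y₀ s y l = y l := by
  simp [mask, hl]

lemma dependsOn_mask (y₀ : ∀ i, Y i) (s : Set (Fin K)) : DependsOn (mask y₀ s) s := by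
  intro y y' h
  ext l
  by_cases hl : l ∈ s
  · simp [mask, hl, h l hl]
  · simp [mask, hl]

/-- Masking restricts a law to the coordinates in `s` without changing the type of the outputs;
events that see only these coordinates do not notice it. -/
lemma preimage_mask_eq {ι : Type*} {s : Set (Fin K)} {E : Set (ι → ∀ i, Y i)}
    (hdep : ∀ y y', (∀ t, ∀ l ∈ s, y t l = y' t l) → y ∈ E → y' ∈ E) (y₀ : ∀ i, Y i) :
    (fun y t => mask y₀ s (y t)) ⁻¹' E = E := by
  ext y
  exact ⟨hdep _ _ fun t l hl => mask_apply_of_mem _ _ hl,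
    hdep _ _ fun t l hl => (mask_apply_of_mem _ _ hl).symm⟩

variable [∀ i, MeasurableSpace (Y i)]

@[fun_prop]
lemma measurable_mask (y₀ : ∀ i, Y i) (s : Set (Fin K)) : Measurable (mask y₀ s) := by
  refine measurable_pi_lambda _ fun l => ?_
  by_cases hl : l ∈ s
  · simpa [mask, hl] using measurable_pi_apply l
  · simp [mask, hl]

/-- The probability of an event that depends only on the coordinates in `s` is determined by the
marginals on these coordinates. -/
lemma pi_apply_congr [∀ i, Nonempty (Y i)] {ι : Type*} [Fintype ι] {s : Set (Fin K)}
    {μ ν : ι → Measure (∀ i, Y i)} [∀ t, IsProbabilityMeasure (μ t)]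
    [∀ t, IsProbabilityMeasure (ν t)]
    (h : ∀ t, ∀ F : (∀ i, Y i) → ℝ≥0∞, Measurable F → DependsOn F s →
      ∫⁻ y, F y ∂(μ t) = ∫⁻ y, F y ∂(ν t))
    {E : Set (ι → ∀ i, Y i)} (hE : MeasurableSet E)
    (hdep : ∀ y y', (∀ t, ∀ l ∈ s, y t l = y' t l) → y ∈ E → y' ∈ E) :
    Measure.pi μ E = Measure.pi ν E := by
  have y₀ : ∀ i, Y i := fun i => Classical.arbitrary _
  have hm := measurable_mask y₀ s
  have hmm : Measurable fun (y : ι → ∀ i, Y i) t => mask y₀ s (y t) := by fun_prop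
  have hmap : ∀ t, (μ t).map (mask y₀ s) = (ν t).map (mask y₀ s) := fun t => by
    ext B hB
    rw [Measure.map_apply hm hB, Measure.map_apply hm hB, ← lintegral_indicator_one (hm hB),
      ← lintegral_indicator_one (hm hB)]
    refine h t _ (measurable_one.indicator (hm hB)) fun y y' hy => ?_
    exact congrArg (B.indicator (1 : (∀ i, Y i) → ℝ≥0∞)) (dependsOn_mask y₀ s hy)
  have hp : ∀ (ρ : ι → Measure (∀ i, Y i)) [∀ t, IsProbabilityMeasure (ρ t)],
      Measure.pi ρ E = Measure.pi (fun t => (ρ t).map (mask y₀ s)) E := fun ρ _ => by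
    have := fun t => Measure.isProbabilityMeasure_map (μ := ρ t) hm.aemeasurable
    rw [← Measure.pi_map_pi (fun _ => hm.aemeasurable), Measure.map_apply hmm hE,
      preimage_mask_eq hdep]
  rw [hp μ, hp ν]
  simp_rw [hmap]

end Mask

/-- Exchanging `w i` and `a` is an involution of the pairs `(w, a)`. -/
lemma sum_sum_update {ι : Type*} [Fintype ι] [DecidableEq ι] {α : ι → Type*}
    [∀ i, Fintype (α i)] {β : Type*} [CommSemiring β] (φ : (∀ i, α i) → β) (i : ι) :
    ∑ w, ∑ a : α i, φ (Function.update w i a) = (∑ w, φ w) * Fintype.card (α i) := by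
  have e : Function.Involutive fun p : (∀ i, α i) × α i => (Function.update p.1 i p.2, p.1 i) := by
    rintro ⟨w, a⟩
    simp
  rw [← Fintype.sum_prod_type' (fun (w : ∀ i, α i) (a : α i) => φ (Function.update w i a)),
    show ∑ p : (∀ i, α i) × α i, φ (Function.update p.1 i p.2) = ∑ p : (∀ i, α i) × α i, φ p.1 from
      Equiv.sum_comp e.toPerm (fun p : (∀ i, α i) × α i => φ p.1), Fintype.sum_prod_type, Finset.sum_mul]
  simp [mul_comm]

variable {K : ℕ} {X Y : Fin K → Type*} [∀ i, MeasurableSpace (Y i)]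
variable {M : Fin K → ℕ} {N : ℕ}

/-- The event that the receivers in `J` decode the messages `w`. -/
def Code.correct (c : Code X Y M N) (J : Finset (Fin K)) (w : ∀ i, Fin (M i)) :
    Set (Fin N → ∀ i, Y i) :=
  {y | ∀ j ∈ J, c.dec j (fun t => y t j) = w j}

lemma Code.measurable_dec_comp (c : Code X Y M N) (j : Fin K) :
    Measurable fun y : Fin N → ∀ i, Y i => c.dec j fun t => y t j :=
  (c.measurable_dec j).comp (by fun_prop)

lemma Code.measurableSet_correct (c : Code X Y M N) (J : Finset (Fin K)) (w : ∀ i, Fin (M i)) :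
    MeasurableSet (c.correct J w) := by
  have : c.correct J w = ⋂ j ∈ J, (fun y : Fin N → ∀ i, Y i => c.dec j fun t => y t j) ⁻¹' {w j} := by
    ext; simp [Code.correct]
  rw [this]
  exact Finset.measurableSet_biInter _ fun j _ =>
    c.measurable_dec_comp j (measurableSet_singleton _)

lemma Code.correct_of_eqOn (c : Code X Y M N) {J : Finset (Fin K)} {w : ∀ i, Fin (M i)}
    {s : Set (Fin K)} (hJ : ∀ j ∈ J, j ∈ s) (y y' : Fin N → ∀ i, Y i)
    (h : ∀ t, ∀ l ∈ s, y t l = y' t l) (hy : y ∈ c.correct J w) : y' ∈ c.correct J w := by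
  intro j hj
  rw [← hy j hj]
  congr 1
  ext t
  exact (h t j (hJ j hj)).symm

lemma Code.input_update_apply (c : Code X Y M N) (w : ∀ i, Fin (M i)) {j l : Fin K} (hl : l < j)
    (a : Fin (M j)) (t : Fin N) : c.input (Function.update w j a) t l = c.input w t l := by
  unfold Code.input
  congr 1
  ext k
  rw [Function.update_of_ne (ne_of_lt (lt_of_le_of_lt k.2 hl))]

/-- Under causal output laws every receiver can only guess its message. -/
theorem Code.sum_pi_correct_mul [∀ i, Nonempty (Y i)] (c : Code X Y M N)
    {Q : (∀ i, X i) → Measure (∀ i, Y i)} [∀ x, IsProbabilityMeasure (Q x)]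
    (hQ : ∀ m : Fin K, ∀ x x', (∀ l < m, x l = x' l) → ∀ F : (∀ i, Y i) → ℝ≥0∞, Measurable F →
        DependsOn F (Set.Iic m) → ∫⁻ y, F y ∂(Q x) = ∫⁻ y, F y ∂(Q x')) (J : Finset (Fin K)) :
    (∑ w, Measure.pi (fun t => Q (c.input w t)) (c.correct J w)) * ∏ j ∈ J, (M j : ℝ≥0∞) =
      Fintype.card (∀ i, Fin (M i)) := by
  -- Remove the last receiver `j` first: the outputs up to `j` do not react to `w j`, so averaging
  -- over `w j` costs exactly a factor `M j`.
  induction J using Finset.induction_on_max with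
  | empty => simp [Code.correct]
  | insert j J hJ ih =>
    have hj : j ∉ J := fun h => lt_irrefl _ (hJ j h)
    rw [Finset.prod_insert hj, ← mul_assoc, ← ih]
    congr 1
    have hcard : (M j : ℝ≥0∞) = (Fintype.card (Fin (M j)) : ℝ≥0∞) := by simp
    rw [hcard, ← sum_sum_update]
    refine Finset.sum_congr rfl fun w _ => ?_
    have hcor : ∀ a, c.correct (insert j J) (Function.update w j a) =
        c.correct J w ∩ (fun y : Fin N → ∀ i, Y i => c.dec j fun t => y t j) ⁻¹' {a} := fun a => by
      ext y
      simp only [Code.correct, Finset.mem_insert, forall_eq_or_imp, Set.mem_ofPred_eq,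
        Function.update_self, Set.mem_inter_iff, Set.mem_preimage, Set.mem_singleton_iff]
      rw [and_comm]
      refine and_congr_left' (forall₂_congr fun l hl => ?_)
      rw [Function.update_of_ne (ne_of_lt (hJ l hl))]
    calc ∑ a, Measure.pi (fun t => Q (c.input (Function.update w j a) t))
          (c.correct (insert j J) (Function.update w j a))
        = ∑ a, Measure.pi (fun t => Q (c.input w t))
          (c.correct J w ∩ (fun y : Fin N → ∀ i, Y i => c.dec j fun t => y t j) ⁻¹' {a}) := by
          refine Finset.sum_congr rfl fun a _ => ?_
          rw [← hcor]
          refine pi_apply_congr (s := Set.Iic j) (fun t F hF hd => ?_)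
            (c.measurableSet_correct _ _) (c.correct_of_eqOn fun l hl => ?_)
          · exact hQ j _ _ (fun l hl => c.input_update_apply w hl a t) F hF hd
          · rcases Finset.mem_insert.1 hl with h | h
            · exact h.le
            · exact (hJ l h).le
      _ = Measure.pi (fun t => Q (c.input w t)) (c.correct J w) := by
          have := sum_measure_preimage_singleton
            (μ := (Measure.pi fun t => Q (c.input w t)).restrict (c.correct J w))
            (f := fun y : Fin N → ∀ i, Y i => c.dec j fun t => y t j) Finset.univ
            (fun a _ => c.measurable_dec_comp j (measurableSet_singleton a))
          simp_rw [Measure.restrict_apply (c.measurable_dec_comp j (measurableSet_singleton _)),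
            Set.inter_comm _ (c.correct J w)] at this
          simpa using this

end CIFC

/-! ### Hypothesis testing and the converse for a single code. -/

namespace CIFC

/-- The tangent of `log` at `2`. The point `2` suits the weight `exp (-L) * (1 + m * 1_E)`, whose
mass is at most `1 + m * b`, where `m * b` averages to `1` over the messages. -/
lemma log_le_half_sub_one_add {u : ℝ} (hu : 0 < u) : Real.log u ≤ u / 2 - 1 + Real.log 2 := by
  have h := Real.log_le_sub_one_of_pos (half_pos hu)
  rw [Real.log_div hu.ne' two_ne_zero] at h
  linarith

/-- A binary hypothesis testing bound: `L` is a log-likelihood ratio, up to a loss of mass, of `P`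
with respect to a law under which the event `E` has probability at most `b`. -/
lemma log_mul_measureReal_le {Ω : Type*} [MeasurableSpace Ω] {P : Measure Ω}
    [IsProbabilityMeasure P] {L : Ω → ℝ} (hL : Integrable L P) {E : Set Ω} (hE : MeasurableSet E)
    {m : ℝ} (hm : 0 < m) {b : ℝ≥0∞} (hb : b ≠ ∞)
    (h1 : ∫⁻ ω, ENNReal.ofReal (Real.exp (-L ω)) ∂P ≤ 1)
    (h2 : ∫⁻ ω in E, ENNReal.ofReal (Real.exp (-L ω)) ∂P ≤ b) :
    Real.log m * P.real E ≤ ∫ ω, L ω ∂P + (m * b.toReal - 1) / 2 + Real.log 2 := by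
  have hmeas : AEStronglyMeasurable (fun ω => Real.exp (-L ω)) P :=
    Real.continuous_exp.comp_aestronglyMeasurable hL.1.neg
  have hexp : Integrable (fun ω => Real.exp (-L ω)) P := by
    refine ⟨hmeas, ?_⟩
    rw [hasFiniteIntegral_iff_ofReal (ae_of_all _ fun ω => Real.exp_nonneg _)]
    exact h1.trans_lt ENNReal.one_lt_top
  have i1 : ∫ ω, Real.exp (-L ω) ∂P ≤ 1 := by
    rw [integral_eq_lintegral_of_nonneg_ae (ae_of_all _ fun ω => Real.exp_nonneg _) hmeas]
    exact ENNReal.toReal_le_of_le_ofReal zero_le_one (by simpa using h1)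
  have i2 : ∫ ω in E, Real.exp (-L ω) ∂P ≤ b.toReal := by
    rw [integral_eq_lintegral_of_nonneg_ae (ae_of_all _ fun ω => Real.exp_nonneg _) hmeas.restrict]
    exact ENNReal.toReal_mono hb h2
  have hEi : Integrable (E.indicator fun _ => Real.log m) P := (integrable_const _).indicator hE
  have hXi : Integrable (E.indicator fun ω => Real.exp (-L ω)) P := hexp.indicator hE
  -- The tangent bound is used at `m * exp (-L)` on `E` and at `exp (-L)` off `E`; the surplus `exp
  -- (-L)` on `E` is non-negative.
  have hpt : ∀ ω, E.indicator (fun _ => Real.log m) ω ≤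
      L ω + ((1 / 2) * (Real.exp (-L ω) + m * E.indicator (fun ω => Real.exp (-L ω)) ω) +
        (Real.log 2 - 1)) := fun ω => by
    have hpos := Real.exp_pos (-L ω)
    by_cases hω : ω ∈ E
    · have h := log_le_half_sub_one_add (mul_pos hm hpos)
      rw [Real.log_mul hm.ne' hpos.ne', Real.log_exp] at h
      simp only [Set.indicator_of_mem hω]
      linarith
    · have h := log_le_half_sub_one_add hpos
      rw [Real.log_exp] at h
      simp only [Set.indicator_of_notMem hω]
      linarith
  have hA : Integrable (fun ω => Real.exp (-L ω) + m * E.indicator (fun ω => Real.exp (-L ω)) ω) P :=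
    hexp.add (hXi.const_mul m)
  have hB : Integrable (fun ω => (1 / 2) * (Real.exp (-L ω) +
      m * E.indicator (fun ω => Real.exp (-L ω)) ω)) P := hA.const_mul _
  have hC : Integrable (fun ω => (1 / 2) * (Real.exp (-L ω) +
      m * E.indicator (fun ω => Real.exp (-L ω)) ω) + (Real.log 2 - 1)) P :=
    hB.add (integrable_const _)
  have hint := integral_mono hEi (hL.add hC) hpt
  simp only [Pi.add_apply] at hint
  rw [integral_indicator hE, setIntegral_const, smul_eq_mul, mul_comm, integral_add hL hC,
    integral_add hB (integrable_const _), integral_const_mul, integral_add hexp (hXi.const_mul m),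
    integral_const_mul, integral_indicator hE, integral_const] at hint
  simp only [probReal_univ, one_smul] at hint
  nlinarith [mul_le_mul_of_nonneg_left i2 hm.le]

variable {K : ℕ} {X Y : Fin K → Type*} [∀ i, MeasurableSpace (X i)] [∀ i, MeasurableSpace (Y i)]
variable {M : Fin K → ℕ} {N : ℕ}

instance (c : Code X Y M N) (ch : Kernel (∀ i, X i) (∀ i, Y i)) [IsMarkovKernel ch]
    (w : ∀ i, Fin (M i)) : IsProbabilityMeasure (c.outputLaw ch w) := by
  unfold Code.outputLaw
  infer_instance

lemma Code.toReal_userErrorProb (c : Code X Y M N) (ch : Kernel (∀ i, X i) (∀ i, Y i))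
    [IsMarkovKernel ch] (j : Fin K) :
    (c.userErrorProb ch j).toReal =
      (∑ w, (c.outputLaw ch w).real {y | c.dec j (fun t => y t j) ≠ w j}) /
        Fintype.card (∀ i, Fin (M i)) := by
  rw [Code.userErrorProb, ENNReal.toReal_div, ENNReal.toReal_sum fun _ _ => measure_ne_top _ _]
  simp [Measure.real]

lemma Code.one_sub_sum_le_correct (c : Code X Y M N) (ch : Kernel (∀ i, X i) (∀ i, Y i))
    [IsMarkovKernel ch] (J : Finset (Fin K)) (w : ∀ i, Fin (M i)) :
    1 - ∑ j ∈ J, (c.outputLaw ch w).real {y | c.dec j (fun t => y t j) ≠ w j} ≤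
      (c.outputLaw ch w).real (c.correct J w) := by
  have h1 := probReal_compl_eq_one_sub (μ := c.outputLaw ch w) (c.measurableSet_correct J w)
  have h2 : (c.correct J w)ᶜ ⊆ ⋃ j ∈ J, {y | c.dec j (fun t => y t j) ≠ w j} := by
    intro y hy
    simpa [Code.correct] using hy
  have h3 := (measureReal_mono h2 (measure_ne_top (c.outputLaw ch w) _)).trans
    (measureReal_biUnion_finset_le J _)
  linarith

/-- The converse for a single code, in nats. -/
theorem Code.converse [∀ i, Nonempty (Y i)] (c : Code X Y M N) (hM : ∀ i, 0 < M i)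
    {ch : Kernel (∀ i, X i) (∀ i, Y i)} [IsMarkovKernel ch] {S : Set (∀ i, X i)}
    (hS : ∀ w t, c.input w t ∈ S) {J : Finset (Fin K)}
    {ℓ : Fin K → (∀ i, X i) → (∀ i, Y i) → ℝ}
    {q : ∀ j, (∀ i, X i) → Kernel (∀ i, Y i) (Y j)}
    (h : ∀ j ∈ J, IsCausalBound ch S J j (ℓ j) (q j)) :
    (1 - ∑ j ∈ J, (c.userErrorProb ch j).toReal) * (∑ j ∈ J, Real.log (M j)) - Real.log 2 ≤
      (∑ w, ∑ t, ∑ j ∈ J, ∫ y, ℓ j (c.input w t) y ∂(ch (c.input w t))) /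
        Fintype.card (∀ i, Fin (M i)) := by
  obtain ⟨Q, hQp, hQc, hQi⟩ := exists_causal_measure h
  have : ∀ i, NeZero (M i) := fun i => ⟨(hM i).ne'⟩
  have y₀ : ∀ i, Y i := fun i => Classical.arbitrary _
  set m : ℝ := ∏ j ∈ J, (M j : ℝ) with hmdef
  have hm : 0 < m := Finset.prod_pos fun j _ => Nat.cast_pos.2 (hM j)
  have hlogm : Real.log m = ∑ j ∈ J, Real.log (M j) :=
    Real.log_prod fun j _ => (Nat.cast_pos.2 (hM j)).ne'
  have hlogm0 : 0 ≤ Real.log m := hlogm ▸ Finset.sum_nonneg fun j _ => Real.log_natCast_nonneg _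
  set W : ℝ := (Fintype.card (∀ i, Fin (M i)) : ℝ) with hW
  have hWpos : 0 < W := Nat.cast_pos.2 Fintype.card_pos
  set L : (∀ i, Fin (M i)) → (Fin N → ∀ i, Y i) → ℝ := fun w y =>
    ∑ t, ∑ j ∈ J, ℓ j (c.input w t) (y t) with hL
  have hint : ∀ w t, Integrable (fun y => ∑ j ∈ J, ℓ j (c.input w t) y) (ch (c.input w t)) :=
    fun w t => integrable_finsetSum _ fun j hj => (h j hj).integrable _ (hS w t)
  have hev : ∀ w t, Integrable (fun y : Fin N → ∀ i, Y i => ∑ j ∈ J, ℓ j (c.input w t) (y t))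
      (c.outputLaw ch w) := fun w t =>
    integrable_comp_eval (μ := fun t => ch (c.input w t)) (hint w t)
  have hLint : ∀ w, Integrable (L w) (c.outputLaw ch w) := fun w =>
    integrable_finsetSum _ fun t _ => hev w t
  have hLval : ∀ w, ∫ y, L w y ∂(c.outputLaw ch w) =
      ∑ t, ∑ j ∈ J, ∫ y, ℓ j (c.input w t) y ∂(ch (c.input w t)) := fun w => by
    rw [integral_finsetSum _ fun t _ => hev w t]
    refine Finset.sum_congr rfl fun t _ => ?_
    rw [← integral_finsetSum _ fun j hj => (h j hj).integrable _ (hS w t)]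
    exact integral_comp_eval (μ := fun t => ch (c.input w t)) (hint w t).1
  -- Tensorization over time of the one-use comparison. The mask is needed because that comparison
  -- holds only for functions of the outputs in `J`.
  have hdens : ∀ w (E : Set (Fin N → ∀ i, Y i)), MeasurableSet E →
      (∀ y y', (∀ t, ∀ l ∈ (J : Set (Fin K)), y t l = y' t l) → y ∈ E → y' ∈ E) →
      ∫⁻ y in E, ENNReal.ofReal (Real.exp (-L w y)) ∂(c.outputLaw ch w) ≤
        Measure.pi (fun t => Q (c.input w t)) E := by
    intro w E hE hdep
    have hmask := measurable_mask y₀ (J : Set (Fin K))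
    have hmm : Measurable fun (y : Fin N → ∀ i, Y i) t => mask y₀ (J : Set (Fin K)) (y t) := by
      fun_prop
    have hprob := fun t =>
      Measure.isProbabilityMeasure_map (μ := Q (c.input w t)) hmask.aemeasurable
    have hmeas : ∀ t, Measurable fun y => ENNReal.ofReal
        (Real.exp (-∑ j ∈ J, ℓ j (c.input w t) y)) := fun t => by
      have : Measurable fun y => ∑ j ∈ J, ℓ j (c.input w t) y :=
        Finset.measurable_sum _ fun j hj => (h j hj).measurable _ (hS w t)
      fun_prop
    have key := setLIntegral_pi_prod_le (fun t => ch (c.input w t))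
      (fun t => (Q (c.input w t)).map (mask y₀ J)) hmeas (fun _ => hmask) (fun t s hs => ?_) hE
    · rw [← Measure.pi_map_pi (fun _ => hmask.aemeasurable), Measure.map_apply hmm hE,
        preimage_mask_eq hdep] at key
      refine le_trans (le_of_eq (lintegral_congr fun y => ?_)) key
      rw [← ENNReal.ofReal_prod_of_nonneg fun _ _ => Real.exp_nonneg _, ← Real.exp_sum,
        Finset.sum_neg_distrib]
    · rw [Measure.map_apply hmask hs, ← lintegral_indicator_one (hmask hs),
        ← lintegral_indicator (hmask hs)]
      refine le_trans (le_of_eq (lintegral_congr fun y => ?_)) (hQi _ (hS w t)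
        ((mask y₀ J ⁻¹' s).indicator 1) (measurable_one.indicator (hmask hs)) fun y y' hy => ?_)
      · by_cases hy : y ∈ mask y₀ J ⁻¹' s <;> simp [hy]
      · exact congrArg (s.indicator (1 : (∀ i, Y i) → ℝ≥0∞)) (dependsOn_mask y₀ _ hy)
  set b : (∀ i, Fin (M i)) → ℝ≥0∞ := fun w =>
    Measure.pi (fun t => Q (c.input w t)) (c.correct J w) with hb
  have hbtop : ∀ w, b w ≠ ∞ := fun w => measure_ne_top _ _
  -- Pure guessing: `m * b w` averages to `1`, so the terms `(m * b w - 1) / 2` cancel in the sum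
  -- over `w`.
  have hbsum : m * ∑ w, (b w).toReal = W := by
    have := congrArg ENNReal.toReal (c.sum_pi_correct_mul hQc J)
    rw [ENNReal.toReal_mul, ENNReal.toReal_sum fun w _ => hbtop w, ENNReal.toReal_prod] at this
    simpa [hmdef, hW, mul_comm] using this
  have hw : ∀ w, Real.log m * (c.outputLaw ch w).real (c.correct J w) ≤
      ∫ y, L w y ∂(c.outputLaw ch w) + (m * (b w).toReal - 1) / 2 + Real.log 2 := fun w => by
    refine log_mul_measureReal_le (hLint w) (c.measurableSet_correct J w) hm (hbtop w) ?_
      (hdens w _ (c.measurableSet_correct J w) (c.correct_of_eqOn fun l hl => hl))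
    simpa using hdens w Set.univ MeasurableSet.univ fun _ _ _ _ => trivial
  have hsum := Finset.sum_le_sum fun w (_ : w ∈ Finset.univ) => hw w
  rw [Finset.sum_add_distrib, Finset.sum_add_distrib, ← Finset.sum_div, Finset.sum_sub_distrib,
    ← Finset.mul_sum, ← Finset.mul_sum, hbsum] at hsum
  have hcor : W - ∑ w, ∑ j ∈ J, (c.outputLaw ch w).real {y | c.dec j (fun t => y t j) ≠ w j} ≤
      ∑ w, (c.outputLaw ch w).real (c.correct J w) := by
    have := Finset.sum_le_sum fun w (_ : w ∈ Finset.univ) => c.one_sub_sum_le_correct ch J w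
    rw [Finset.sum_sub_distrib] at this
    simpa [hW] using this
  have herr : ∑ w, ∑ j ∈ J, (c.outputLaw ch w).real {y | c.dec j (fun t => y t j) ≠ w j} =
      W * ∑ j ∈ J, (c.userErrorProb ch j).toReal := by
    rw [Finset.sum_comm, Finset.mul_sum]
    refine Finset.sum_congr rfl fun j _ => ?_
    rw [c.toReal_userErrorProb, mul_div_cancel₀ _ hWpos.ne']
  rw [herr] at hcor
  have hfin := mul_le_mul_of_nonneg_left hcor hlogm0
  simp only [Finset.sum_const, Finset.card_univ, nsmul_eq_mul, ← hW, mul_one] at hsum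
  simp_rw [hLval] at hsum
  rw [le_div_iff₀ hWpos, ← hlogm]
  nlinarith

end CIFC

/-! ### Information densities as causal bounds. -/

namespace CIFC

section CondMutualInfo

variable {Ω α β γ : Type*} [MeasurableSpace Ω]
  [MeasurableSpace α] [StandardBorelSpace α] [Nonempty α]
  [MeasurableSpace β] [StandardBorelSpace β] [Nonempty β] [MeasurableSpace γ]

lemma lintegral_condDistrib (μ : Measure Ω) [IsFiniteMeasure μ] {B : Ω → β} {C : Ω → γ}
    (hB : Measurable B) (hC : Measurable C) {G : γ × β → ℝ≥0∞} (hG : Measurable G) :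
    ∫⁻ ω, ∫⁻ b, G (C ω, b) ∂(condDistrib B C μ (C ω)) ∂μ = ∫⁻ ω, G (C ω, B ω) ∂μ := by
  have h := compProd_map_condDistrib (mβ := ‹MeasurableSpace γ›) (μ := μ) (X := C)
    hB.aemeasurable
  have h1 := congrArg (fun ρ => ∫⁻ z, G z ∂ρ) h
  rw [Measure.lintegral_compProd hG, lintegral_map hG (hC.prodMk hB),
    lintegral_map hG.lintegral_kernel_prod_right' hC] at h1
  exact h1

/-- The information density: its integral is the conditional mutual information in nats, and it is
a log-likelihood ratio with respect to resampling `A` given `C`. -/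
lemma exists_information_density (μ : Measure Ω) [IsProbabilityMeasure μ] {A : Ω → α} {B : Ω → β}
    {C : Ω → γ} (hA : Measurable A) (hB : Measurable B) (hC : Measurable C)
    (hI : condMutualInfo μ A B C ≠ ∞) :
    ∃ ℓ : γ × α × β → ℝ, Measurable ℓ ∧ Integrable (fun ω => ℓ (C ω, A ω, B ω)) μ ∧
      ∫ ω, ℓ (C ω, A ω, B ω) ∂μ = Real.log 2 * (condMutualInfo μ A B C).toReal ∧
      ∀ F : γ × α × β → ℝ≥0∞, Measurable F →
        ∫⁻ ω, F (C ω, A ω, B ω) * ENNReal.ofReal (Real.exp (-ℓ (C ω, A ω, B ω))) ∂μ ≤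
          ∫⁻ ω, ∫⁻ a, F (C ω, a, B ω) ∂(condDistrib A C μ (C ω)) ∂μ := by
  have hm : Measurable fun ω => (C ω, A ω, B ω) := hC.prodMk (hA.prodMk hB)
  have hlog2 : 0 < Real.log 2 := Real.log_pos one_lt_two
  set ρ := μ.map fun ω => (C ω, A ω, B ω) with hρ
  set ν := μ.map C ⊗ₘ (condDistrib A C μ ×ₖ condDistrib B C μ) with hν
  have : IsProbabilityMeasure ρ := Measure.isProbabilityMeasure_map hm.aemeasurable
  have : IsProbabilityMeasure (μ.map C) := Measure.isProbabilityMeasure_map hC.aemeasurable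
  have hdef : condMutualInfo μ A B C =
      InformationTheory.klDiv ρ ν / ENNReal.ofReal (Real.log 2) := rfl
  have hkl : InformationTheory.klDiv ρ ν ≠ ∞ := fun h => hI (by
    rw [hdef, h, ENNReal.top_div_of_ne_top ENNReal.ofReal_ne_top])
  obtain ⟨hac, hint⟩ := InformationTheory.klDiv_ne_top_iff.1 hkl
  refine ⟨llr ρ ν, measurable_llr _ _, ?_, ?_, fun F hF => ?_⟩
  · exact (integrable_map_measure (measurable_llr _ _).aestronglyMeasurable hm.aemeasurable).1 hint
  · rw [hdef, ENNReal.toReal_div, ENNReal.toReal_ofReal hlog2.le, mul_div_cancel₀ _ hlog2.ne',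
      InformationTheory.toReal_klDiv_of_measure_eq hac (by simp), hρ,
      integral_map hm.aemeasurable (measurable_llr _ _).aestronglyMeasurable]
  · calc ∫⁻ ω, F (C ω, A ω, B ω) * ENNReal.ofReal (Real.exp (-llr ρ ν (C ω, A ω, B ω))) ∂μ
        = ∫⁻ z, F z * ENNReal.ofReal (Real.exp (-llr ρ ν z)) ∂ρ := by
          rw [hρ, lintegral_map _ hm]
          exact hF.mul (Real.measurable_exp.comp (measurable_llr _ _).neg).ennreal_ofReal
      _ = ∫⁻ z, ν.rnDeriv ρ z * F z ∂ρ := by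
          refine lintegral_congr_ae ?_
          filter_upwards [exp_neg_llr hac, ν.rnDeriv_lt_top ρ] with z hz hz'
          rw [hz, ENNReal.ofReal_toReal hz'.ne, mul_comm]
      _ = ∫⁻ z, F z ∂(ρ.withDensity (ν.rnDeriv ρ)) :=
          (lintegral_withDensity_eq_lintegral_mul _ (Measure.measurable_rnDeriv _ _) hF).symm
      -- Only `ρ ≪ ν` is known: the part of `ν` singular to `ρ` is lost, hence an inequality.
      _ ≤ ∫⁻ z, F z ∂ν := lintegral_mono' (Measure.withDensity_rnDeriv_le _ _) le_rfl
      _ = ∫⁻ ω, ∫⁻ b, ∫⁻ a, F (C ω, a, b) ∂(condDistrib A C μ (C ω))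
            ∂(condDistrib B C μ (C ω)) ∂μ := by
          rw [hν, Measure.lintegral_compProd hF, lintegral_map hF.lintegral_kernel_prod_right' hC]
          refine lintegral_congr fun ω => ?_
          rw [Kernel.prod_apply, lintegral_prod_symm' _ (by fun_prop)]
      -- Drawing `B` afresh given `C` restores the true law of `(C, B)`; only `A` stays resampled.
      _ = ∫⁻ ω, ∫⁻ a, F (C ω, a, B ω) ∂(condDistrib A C μ (C ω)) ∂μ := by
          refine lintegral_condDistrib μ hB hC
            (G := fun p => ∫⁻ a, F (p.1, a, p.2) ∂(condDistrib A C μ p.1)) ?_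
          exact Measurable.lintegral_kernel_prod_right'
            (κ := (condDistrib A C μ).comap (Prod.fst : γ × β → γ) measurable_fst)
            (f := fun p : (γ × β) × α => F (p.1.1, p.2, p.1.2)) (by fun_prop)

end CondMutualInfo

variable {K : ℕ} {X Y : Fin K → Type*} [∀ i, MeasurableSpace (X i)] [∀ i, MeasurableSpace (Y i)]

/-- Localizes at an atom: inequalities averaged over `P` become inequalities at each input of
positive mass. -/
lemma lintegral_compProd_indicator_singleton {α β : Type*} [MeasurableSpace α]
    [MeasurableSingletonClass α] [MeasurableSpace β] (P : Measure α) [SFinite P]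
    (κ : Kernel α β) [IsSFiniteKernel κ] (x : α) {G : α × β → ℝ≥0∞} (hG : Measurable G) :
    ∫⁻ z, ({x} : Set α).indicator 1 z.1 * G z ∂(P ⊗ₘ κ) = P {x} * ∫⁻ y, G (x, y) ∂(κ x) := by
  have h1 : Measurable (({x} : Set α).indicator (1 : α → ℝ≥0∞)) :=
    measurable_one.indicator (measurableSet_singleton x)
  rw [Measure.lintegral_compProd (f := fun z => ({x} : Set α).indicator 1 z.1 * G z)
    ((h1.comp measurable_fst).mul hG)]
  have h2 : ∀ x', ∫⁻ y, ({x} : Set α).indicator 1 x' * G (x', y) ∂(κ x') =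
      ({x} : Set α).indicator (fun x' => ∫⁻ y, G (x', y) ∂(κ x')) x' := fun x' => by
    by_cases hx : x' ∈ ({x} : Set α) <;> simp [hx]
  simp_rw [h2]
  rw [lintegral_indicator (measurableSet_singleton x), lintegral_singleton, mul_comm]

lemma of_ae_of_singleton_ne_zero {α : Type*} [MeasurableSpace α] {P : Measure α} {p : α → Prop}
    (h : ∀ᵐ x ∂P, p x) {x : α} (hx : P {x} ≠ 0) : p x := by
  by_contra hp
  exact hx (measure_mono_null (by simpa using hp) (ae_iff.1 h))

variable [∀ i, StandardBorelSpace (X i)] [∀ i, Nonempty (X i)]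
  [∀ i, StandardBorelSpace (Y i)] [∀ i, Nonempty (Y i)]

/-- The information density of a finite `I(Y_j; X_j, …, X_K | C)`, where `C` is made of the inputs
before `j` and the outputs in `J` before `j`, is a causal bound at the atoms of `P`. The map `ρ`
recovers the inputs and the outputs in `J` up to `j`. -/
theorem exists_isCausalBound (P : Measure (∀ i, X i)) [IsProbabilityMeasure P]
    (ch : Kernel (∀ i, X i) (∀ i, Y i)) [IsMarkovKernel ch] {J : Finset (Fin K)} {j : Fin K}
    (hj : j ∈ J) {γ : Type*} [MeasurableSpace γ] {C : (∀ i, X i) × (∀ i, Y i) → γ}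
    (hC : Measurable C) (hCx : ∀ y, DependsOn (fun x => C (x, y)) {l | l < j})
    (hCy : ∀ x, DependsOn (fun y => C (x, y)) {l | l ∈ J ∧ l < j})
    {ρ : γ × Y j × (∀ l : Set.Ici j, X l) → (∀ i, X i) × (∀ i, Y i)} (hρ : Measurable ρ)
    (hρx : ∀ z a, (ρ (C z, a, fun l => z.1 l)).1 = z.1)
    (hρy : ∀ z a, ∀ l ∈ J, l ≤ j →
      (ρ (C z, a, fun l => z.1 l)).2 l = Function.update z.2 j a l)
    (hI : condMutualInfo (P ⊗ₘ ch) (fun z => z.2 j) (fun z (l : Set.Ici j) => z.1 l) C ≠ ∞) :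
    ∃ (ℓ : (∀ i, X i) → (∀ i, Y i) → ℝ) (q : (∀ i, X i) → Kernel (∀ i, Y i) (Y j)),
      IsCausalBound ch {x | P {x} ≠ 0} J j ℓ q ∧
      ∫ x, ∫ y, ℓ x y ∂(ch x) ∂P = Real.log 2 *
        (condMutualInfo (P ⊗ₘ ch) (fun z => z.2 j) (fun z (l : Set.Ici j) => z.1 l) C).toReal := by
  have hA : Measurable fun z : (∀ i, X i) × (∀ i, Y i) => z.2 j := by fun_prop
  have hB : Measurable fun (z : (∀ i, X i) × (∀ i, Y i)) (l : Set.Ici j) => z.1 l := by fun_prop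
  obtain ⟨ℓ, hℓ, hint, hval, hle⟩ := exists_information_density (P ⊗ₘ ch) hA hB hC hI
  set κ := condDistrib (fun z : (∀ i, X i) × (∀ i, Y i) => z.2 j) C (P ⊗ₘ ch) with hκ
  have hCm : ∀ x, Measurable fun y => C (x, y) := fun x => hC.comp measurable_prodMk_left
  have hm : Measurable fun z : (∀ i, X i) × (∀ i, Y i) =>
      (C z, z.2 j, fun l : Set.Ici j => z.1 l) := hC.prodMk (hA.prodMk hB)
  have hii := (Measure.integrable_compProd_iff hint.1).1 hint
  refine ⟨fun x y => ℓ (C (x, y), y j, fun l => x l), fun x => κ.comap _ (hCm x),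
    ⟨?_, ?_, ?_, ?_, ?_, ?_, ?_⟩, ?_⟩
  · exact fun x _ => hℓ.comp (hm.comp measurable_prodMk_left)
  · intro x _ y y' h
    have h1 : C (x, y) = C (x, y') := hCy x fun l hl => h l ⟨hl.1, hl.2.le⟩
    have h2 : y j = y' j := h j ⟨hj, le_rfl⟩
    simp only [h1, h2]
  · exact fun x hx => of_ae_of_singleton_ne_zero hii.1 hx
  · intro x; infer_instance
  · intro x x' h
    ext y : 1
    have h1 : C (x, y) = C (x', y) := hCx y h
    simp [Kernel.comap_apply, h1]
  · intro x y y' h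
    have h1 : C (x, y) = C (x, y') := hCy x h
    simp [Kernel.comap_apply, h1]
  · intro x hx F hF hd
    have hind : Measurable (({x} : Set (∀ i, X i)).indicator (1 : (∀ i, X i) → ℝ≥0∞)) :=
      measurable_one.indicator (measurableSet_singleton x)
    -- Test against the indicator of the input `x`, read off through `ρ`; the factor `P {x}` is
    -- cancelled at the end.
    have key := hle (fun p => ({x} : Set (∀ i, X i)).indicator 1 (ρ p).1 * F (ρ p).2)
      ((hind.comp (measurable_fst.comp hρ)).mul (hF.comp (measurable_snd.comp hρ)))
    have hFρ : ∀ z a, F (ρ (C z, a, fun l => z.1 l)).2 = F (Function.update z.2 j a) := fun z a =>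
      hd fun l hl => hρy z a l hl.1 hl.2
    have hFu : Measurable fun p : ((∀ i, X i) × (∀ i, Y i)) × Y j =>
        F (Function.update p.1.2 j p.2) :=
      hF.comp (measurable_update'.comp
        ((measurable_snd.comp measurable_fst).prodMk measurable_snd))
    simp only [hρx, hFρ, Function.update_eq_self, mul_assoc] at key
    have hcm : ∀ z : (∀ i, X i) × (∀ i, Y i), ∫⁻ a, ({x} : Set (∀ i, X i)).indicator 1 z.1 *
        F (Function.update z.2 j a) ∂(κ (C z)) = ({x} : Set (∀ i, X i)).indicator 1 z.1 *
          ∫⁻ a, F (Function.update z.2 j a) ∂(κ (C z)) := fun z =>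
      lintegral_const_mul _ (hF.comp (measurable_update z.2))
    simp_rw [hcm] at key
    rw [lintegral_compProd_indicator_singleton P ch x
        (G := fun z => F z.2 * ENNReal.ofReal (Real.exp (-ℓ (C z, z.2 j, fun l => z.1 l))))
        ((hF.comp measurable_snd).mul
          (Real.measurable_exp.comp (hℓ.comp hm).neg).ennreal_ofReal),
      lintegral_compProd_indicator_singleton P ch x
        (G := fun z => ∫⁻ a, F (Function.update z.2 j a) ∂(κ (C z)))
        (Measurable.lintegral_kernel_prod_right' (κ := κ.comap C hC) hFu),
      ENNReal.mul_le_mul_iff_right hx (measure_ne_top _ _)] at key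
    simpa [Kernel.comap_apply] using key
  · rw [← hval, Measure.integral_compProd hint]

end CIFC

/-! ### Invariance under equal marginals, mixed kernels, and the two kinds of bounds. -/

namespace CIFC

variable {K : ℕ} {X Y : Fin K → Type*} [∀ i, MeasurableSpace (X i)] [∀ i, MeasurableSpace (Y i)]

/-- The block at receiver `j` has the product of the marginal kernels as its law, and these are
shared by the two channels. -/
lemma outputLaw_apply_congr {M : Fin K → ℕ} {N : ℕ} (c : Code X Y M N)
    {ch ch' : Kernel (∀ i, X i) (∀ i, Y i)} [IsMarkovKernel ch] [IsMarkovKernel ch']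
    (h : SameMarginals ch ch') (w : ∀ i, Fin (M i)) (j : Fin K) {E : Set (Fin N → Y j)}
    (hE : MeasurableSet E) :
    c.outputLaw ch' w {y | (fun t => y t j) ∈ E} = c.outputLaw ch w {y | (fun t => y t j) ∈ E} := by
  have hev : Measurable fun y : ∀ i, Y i => y j := measurable_pi_apply j
  have key : ∀ (κ : Kernel (∀ i, X i) (∀ i, Y i)) [IsMarkovKernel κ],
      c.outputLaw κ w {y | (fun t => y t j) ∈ E} =
        Measure.pi (fun t => κ.map (fun y => y j) (c.input w t)) E := fun κ _ => by
    have := fun t => Measure.isProbabilityMeasure_map (μ := κ (c.input w t)) hev.aemeasurable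
    simp_rw [Kernel.map_apply _ hev]
    rw [← Measure.pi_map_pi (fun _ => hev.aemeasurable), Measure.map_apply (by fun_prop) hE]
    rfl
  rw [key, key, h j]

lemma Code.userErrorProb_congr {M : Fin K → ℕ} {N : ℕ} (c : Code X Y M N)
    {ch ch' : Kernel (∀ i, X i) (∀ i, Y i)} [IsMarkovKernel ch] [IsMarkovKernel ch']
    (h : SameMarginals ch ch') (j : Fin K) :
    c.userErrorProb ch' j = c.userErrorProb ch j := by
  unfold Code.userErrorProb
  congr 1
  refine Finset.sum_congr rfl fun w _ => ?_
  exact outputLaw_apply_congr c h w j (E := {y | c.dec j y ≠ w j})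
    (c.measurable_dec j (measurableSet_singleton (w j)).compl)

/-- A finite mixture of kernels. -/
noncomputable def mixture {ι α β : Type*} [Fintype ι] [MeasurableSpace α] [MeasurableSpace β]
    (p : ι → ℝ≥0∞) (κ : ι → Kernel α β) : Kernel α β where
  toFun a := ∑ i, p i • κ i a
  measurable' := by
    refine Measure.measurable_of_measurable_coe _ fun s hs => ?_
    simp only [Measure.coe_finsetSum, Finset.sum_apply, Measure.smul_apply, smul_eq_mul]
    exact Finset.measurable_sum _ fun i _ => ((κ i).measurable_coe hs).const_mul _

lemma mixture_apply {ι α β : Type*} [Fintype ι] [MeasurableSpace α] [MeasurableSpace β]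
    (p : ι → ℝ≥0∞) (κ : ι → Kernel α β) (a : α) : mixture p κ a = ∑ i, p i • κ i a := rfl

lemma isMarkovKernel_mixture {ι α β : Type*} [Fintype ι] [MeasurableSpace α] [MeasurableSpace β]
    {p : ι → ℝ≥0∞} (hp : ∑ i, p i = 1) (κ : ι → Kernel α β) [∀ i, IsMarkovKernel (κ i)] :
    IsMarkovKernel (mixture p κ) := by
  refine ⟨fun a => ⟨?_⟩⟩
  simp [mixture_apply, hp]

lemma mul_lintegral_le_mixture {ι α β : Type*} [Fintype ι] [MeasurableSpace α] [MeasurableSpace β]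
    (p : ι → ℝ≥0∞) (κ : ι → Kernel α β) (i : ι) (a : α) (F : β → ℝ≥0∞) :
    p i * ∫⁻ b, F b ∂(κ i a) ≤ ∫⁻ b, F b ∂(mixture p κ a) := by
  rw [mixture_apply, lintegral_finsetSum_measure]
  simp_rw [lintegral_smul_measure, smul_eq_mul]
  exact Finset.single_le_sum (f := fun i => p i * ∫⁻ b, F b ∂(κ i a)) (fun _ _ => zero_le)
    (Finset.mem_univ i)

variable [∀ i, StandardBorelSpace (Y i)] [∀ i, Nonempty (Y i)]

/-- Resampling the coordinate `j` given the coordinates in `s` does not change the law of the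
coordinates in `s` and `j`. -/
lemma lintegral_resample_condDistrib (μ : Measure (∀ i, Y i)) [IsProbabilityMeasure μ]
    (y₀ : ∀ i, Y i) {j : Fin K} {s : Set (Fin K)} {F : (∀ i, Y i) → ℝ≥0∞} (hF : Measurable F)
    (hd : DependsOn F (insert j s)) :
    ∫⁻ y, ∫⁻ a, F (Function.update y j a)
      ∂(condDistrib (fun y : ∀ i, Y i => y j) (mask y₀ s) μ (mask y₀ s y)) ∂μ = ∫⁻ y, F y ∂μ := by
  have hu : ∀ y a, F (Function.update (mask y₀ s y) j a) = F (Function.update y j a) := by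
    intro y a
    refine hd fun l hl => ?_
    by_cases hlj : l = j
    · subst hlj; simp
    · rw [Function.update_of_ne hlj, Function.update_of_ne hlj,
        mask_apply_of_mem _ _ (Set.mem_of_mem_insert_of_ne hl hlj)]
  have h := lintegral_condDistrib μ (measurable_pi_apply j) (measurable_mask y₀ s)
    (G := fun p => F (Function.update p.1 j p.2)) (hF.comp measurable_update')
  simp only [hu, Function.update_eq_self] at h
  exact h

/-- A causal bound on `S` extends to all inputs of a finite alphabet, at the cost of mixing its
kernel with the guess of a uniformly distributed input. -/
theorem IsCausalBound.exists_mixture [Fintype (∀ i, X i)] [Nonempty (∀ i, X i)]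
    {ch : Kernel (∀ i, X i) (∀ i, Y i)} [IsMarkovKernel ch] {S : Set (∀ i, X i)}
    [DecidablePred (· ∈ S)] {J : Finset (Fin K)} {j : Fin K} (hj : j ∈ J)
    {ℓ : (∀ i, X i) → (∀ i, Y i) → ℝ}
    {q : (∀ i, X i) → Kernel (∀ i, Y i) (Y j)} (h : IsCausalBound ch S J j ℓ q)
    {δ : ℝ} (hδ : 0 < δ) (hδ1 : δ < 1) :
    ∃ q', IsCausalBound ch Set.univ J j (fun x y => if x ∈ S then ℓ x y - Real.log (1 - δ) else
      Real.log (Fintype.card (∀ i, X i)) - Real.log δ) q' := by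
  have y₀ : ∀ i, Y i := fun i => Classical.arbitrary _
  set s : Set (Fin K) := {l | l ∈ J ∧ l < j} with hs
  set n : ℝ := (Fintype.card (∀ i, X i) : ℝ) with hn
  have hnpos : 0 < n := Nat.cast_pos.2 Fintype.card_pos
  have hins : {l | l ∈ J ∧ l ≤ j} = insert j s := by
    ext l
    simp only [hs, Set.mem_insert_iff, Set.mem_ofPred_eq, le_iff_lt_or_eq]
    constructor
    · rintro ⟨h1, h2 | h2⟩
      · exact Or.inr ⟨h1, h2⟩
      · exact Or.inl h2
    · rintro (rfl | ⟨h1, h2⟩)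
      · exact ⟨hj, Or.inr rfl⟩
      · exact ⟨h1, Or.inl h2⟩
  set p : Option (∀ i, X i) → ℝ≥0∞ := fun o =>
    o.elim (ENNReal.ofReal (1 - δ)) fun _ => ENNReal.ofReal (δ / n) with hp
  have hpsum : ∑ o, p o = 1 := by
    rw [Fintype.sum_option]
    simp only [hp, Option.elim, Finset.sum_const, Finset.card_univ, nsmul_eq_mul]
    rw [← ENNReal.ofReal_natCast, ← ENNReal.ofReal_mul (Nat.cast_nonneg _),
      ← ENNReal.ofReal_add (by linarith) (by positivity), ← hn, mul_div_cancel₀ _ hnpos.ne']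
    simp
  -- `none` is the given kernel. `some x'` draws output `j` as if the input were `x'`; it never
  -- looks at the true `x`, so causality survives.
  set κ : (∀ i, X i) → Option (∀ i, X i) → Kernel (∀ i, Y i) (Y j) := fun x o =>
    o.elim (q x) fun x' => (condDistrib (fun y : ∀ i, Y i => y j) (mask y₀ s) (ch x')).comap
      (mask y₀ s) (measurable_mask y₀ s) with hκ
  have hκm : ∀ x o, IsMarkovKernel (κ x o) := by
    rintro x (_ | x')
    · exact h.markov x
    · simp only [hκ, Option.elim]
      infer_instance
  refine ⟨fun x => mixture p (κ x), ⟨fun x _ => ?_, fun x _ => ?_, fun x _ => ?_,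
    fun x => isMarkovKernel_mixture hpsum _, fun x x' hxx => ?_, fun x y y' hyy => ?_,
    fun x _ F hF hd => ?_⟩⟩
  · by_cases hx : x ∈ S
    · simpa [hx] using (h.measurable x hx).sub_const _
    · simp [hx]
  · intro y y' hy
    by_cases hx : x ∈ S
    · simp [hx, h.dependsOn x hx hy]
    · simp [hx]
  · by_cases hx : x ∈ S
    · simp only [hx, if_true]
      exact (h.integrable x hx).sub (integrable_const _)
    · simp [hx]
  · have hq : q x = q x' := h.kernel_causal hxx
    simp [hκ, hq]
  · have hq : q x y = q x y' := h.kernel_dependsOn x hyy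
    have hmk : mask y₀ s y = mask y₀ s y' := dependsOn_mask y₀ s hyy
    simp only [mixture_apply]
    refine Finset.sum_congr rfl fun o _ => ?_
    rcases o with _ | x'
    · simp [hκ, hq]
    · simp [hκ, Kernel.comap_apply, hmk]
  · have hmix : ∀ o, p o * ∫⁻ y, ∫⁻ a, F (Function.update y j a) ∂(κ x o y) ∂(ch x) ≤
        ∫⁻ y, ∫⁻ a, F (Function.update y j a) ∂(mixture p (κ x) y) ∂(ch x) := fun o => by
      have := hκm x o
      rw [← lintegral_const_mul _ (measurable_lintegral_update _ hF)]
      exact lintegral_mono fun y =>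
        mul_lintegral_le_mixture p (κ x) o y fun a => F (Function.update y j a)
    by_cases hx : x ∈ S
    · have hexp : ∀ y, ENNReal.ofReal (Real.exp (-(ℓ x y - Real.log (1 - δ)))) =
          ENNReal.ofReal (1 - δ) * ENNReal.ofReal (Real.exp (-ℓ x y)) := fun y => by
        rw [← ENNReal.ofReal_mul (by linarith), neg_sub, sub_eq_add_neg, Real.exp_add,
          Real.exp_log (by linarith)]
      simp only [hx, if_true, hexp, mul_left_comm (F _)]
      have hm := h.measurable x hx
      rw [lintegral_const_mul _ (by fun_prop)]
      exact (mul_le_mul_right (h.lintegral_le x hx F hF hd) _).trans (hmix none)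
    -- Off `S`, the correct guess `x' = x` has weight `δ / n`, and resampling from the true
    -- conditional law leaves the integral of `F` unchanged.
    · have hexp : ENNReal.ofReal (Real.exp (-(Real.log n - Real.log δ))) =
          ENNReal.ofReal (δ / n) := by
        rw [neg_sub, ← Real.log_div hδ.ne' hnpos.ne', Real.exp_log (by positivity)]
      simp only [hx, if_false, hexp]
      rw [lintegral_mul_const _ hF, mul_comm,
        ← lintegral_resample_condDistrib (ch x) y₀ (s := s) hF (hins ▸ hd)]
      exact hmix (some x)

variable [∀ i, StandardBorelSpace (X i)] [∀ i, Nonempty (X i)]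

lemma exists_isCausalBound_progressiveTerm (P : Measure (∀ i, X i)) [IsProbabilityMeasure P]
    (ch : Kernel (∀ i, X i) (∀ i, Y i)) [IsMarkovKernel ch] {i j : Fin K} (hij : i ≤ j)
    (hI : progressiveTerm P ch i j ≠ ∞) :
    ∃ (ℓ : (∀ i, X i) → (∀ i, Y i) → ℝ) (q : (∀ i, X i) → Kernel (∀ i, Y i) (Y j)),
      IsCausalBound ch {x | P {x} ≠ 0} (Finset.Ici i) j ℓ q ∧
      ∫ x, ∫ y, ℓ x y ∂(ch x) ∂P = Real.log 2 * (progressiveTerm P ch i j).toReal := by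
  classical
  have y₀ : ∀ i, Y i := fun i => Classical.arbitrary _
  have hext : Measurable fun (v : ∀ l : Set.Ico i j, Y l) (l : Fin K) =>
      if h : l ∈ Set.Ico i j then v ⟨l, h⟩ else y₀ l := by
    refine measurable_pi_lambda _ fun l => ?_
    by_cases h : l ∈ Set.Ico i j
    · simp only [h, dif_pos]
      fun_prop
    · simp only [h, dif_neg, not_false_eq_true]
      fun_prop
  refine exists_isCausalBound P ch (Finset.mem_Ici.2 hij)
    (C := fun z => ((fun l : Set.Iio j => z.1 l), (fun l : Set.Ico i j => z.2 l)))
    -- Glue the inputs before and from `j`. Outputs outside `[i, j]` get the default `y₀`, which is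
    -- never tested.
    (ρ := fun p => (fun l => if h : l ∈ Set.Iio j then p.1.1 ⟨l, h⟩ else p.2.2 ⟨l, Set.notMem_Iio.1 h⟩,
      Function.update (fun l => if h : l ∈ Set.Ico i j then p.1.2 ⟨l, h⟩ else y₀ l) j p.2.1))
    (by fun_prop) (fun y x x' h => ?_) (fun x y y' h => ?_) ?_ (fun z a => ?_)
    (fun z a l hl hlj => ?_) hI
  · exact Prod.ext (funext fun l => h l l.2) rfl
  · exact Prod.ext rfl (funext fun l => h l ⟨Finset.mem_Ici.2 l.2.1, l.2.2⟩)
  · refine Measurable.prodMk (measurable_pi_lambda _ fun l => ?_) (measurable_update'.comp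
      ((hext.comp (measurable_snd.comp measurable_fst)).prodMk (by fun_prop)))
    by_cases h : l ∈ Set.Iio j
    · simp only [h, dif_pos]
      fun_prop
    · simp only [h, dif_neg, not_false_eq_true]
      fun_prop
  · ext l
    by_cases h : l < j <;> simp [h]
  · by_cases h : l = j
    · subst h; simp
    · simp [Function.update_of_ne h, Finset.mem_Ici.1 hl, lt_of_le_of_ne hlj h]

lemma exists_isCausalBound_singleBound (P : Measure (∀ i, X i)) [IsProbabilityMeasure P]
    (ch : Kernel (∀ i, X i) (∀ i, Y i)) [IsMarkovKernel ch] {i : Fin K}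
    (hI : singleBound P ch i ≠ ∞) :
    ∃ (ℓ : (∀ i, X i) → (∀ i, Y i) → ℝ) (q : (∀ i, X i) → Kernel (∀ i, Y i) (Y i)),
      IsCausalBound ch {x | P {x} ≠ 0} {i} i ℓ q ∧
      ∫ x, ∫ y, ℓ x y ∂(ch x) ∂P = Real.log 2 * (singleBound P ch i).toReal := by
  classical
  have y₀ : ∀ i, Y i := fun i => Classical.arbitrary _
  refine exists_isCausalBound P ch (Finset.mem_singleton_self i)
    (C := fun z (l : Set.Iio i) => z.1 l)
    (ρ := fun p => (fun l => if h : l ∈ Set.Iio i then p.1 ⟨l, h⟩ else p.2.2 ⟨l, Set.notMem_Iio.1 h⟩,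
      Function.update y₀ i p.2.1))
    (by fun_prop) (fun y x x' h => ?_) (fun x y y' h => rfl) ?_ (fun z a => ?_)
    (fun z a l hl hlj => ?_) hI
  · exact funext fun l => h l l.2
  · refine Measurable.prodMk (measurable_pi_lambda _ fun l => ?_)
      ((measurable_update y₀).comp (by fun_prop))
    by_cases h : l ∈ Set.Iio i
    · simp only [h, dif_pos]
      fun_prop
    · simp only [h, dif_neg, not_false_eq_true]
      fun_prop
  · ext l
    by_cases h : l < i <;> simp [h]
  · obtain rfl := Finset.mem_singleton.1 hl
    simp

end CIFC

/-! ### Empirical input distributions and passage to the limit. -/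

namespace CIFC

section FiniteSupport

variable {ι α : Type*} [Fintype ι] [MeasurableSpace α]

/-- The measure with mass `a i` at the point `x i`. -/
noncomputable def pointMasses (a : ι → ℝ) (x : ι → α) : Measure α :=
  ∑ i, ENNReal.ofReal (a i) • Measure.dirac (x i)

lemma isProbabilityMeasure_pointMasses {a : ι → ℝ} (ha : ∀ i, 0 ≤ a i) (h1 : ∑ i, a i = 1)
    (x : ι → α) : IsProbabilityMeasure (pointMasses a x) := by
  refine ⟨?_⟩
  simp only [pointMasses, Measure.coe_finsetSum, Finset.sum_apply, Measure.smul_apply,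
    measure_univ, smul_eq_mul, mul_one]
  rw [← ENNReal.ofReal_sum_of_nonneg fun i _ => ha i, h1, ENNReal.ofReal_one]

variable [MeasurableSingletonClass α]

lemma pointMasses_singleton_ne_zero (a : ι → ℝ) (x : ι → α) {i : ι} (hi : 0 < a i) :
    pointMasses a x {x i} ≠ 0 := by
  simp only [pointMasses, Measure.coe_finsetSum, Finset.sum_apply, Measure.smul_apply, smul_eq_mul]
  refine fun h => ?_
  have := (Finset.sum_eq_zero_iff.1 h) i (Finset.mem_univ i)
  simp at this
  linarith

lemma integral_pointMasses {a : ι → ℝ} (ha : ∀ i, 0 ≤ a i) (x : ι → α) (g : α → ℝ) :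
    ∫ z, g z ∂(pointMasses a x) = ∑ i, a i * g (x i) := by
  have hint : ∀ i ∈ Finset.univ, Integrable g (ENNReal.ofReal (a i) • Measure.dirac (x i)) :=
    fun i _ => (integrable_dirac (by simp)).smul_measure ENNReal.ofReal_ne_top
  rw [pointMasses, integral_finsetSum_measure hint]
  refine Finset.sum_congr rfl fun i _ => ?_
  rw [integral_smul_measure, integral_dirac, ENNReal.toReal_ofReal (ha i), smul_eq_mul]

end FiniteSupport

lemma numMessages_pos {N : ℕ} {r : ℝ} (hr : 0 ≤ r) : 0 < numMessages N r :=
  Nat.floor_pos.2 (Real.one_le_rpow one_le_two (by positivity))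

/-- A floor of a number at least `1` loses less than a factor `2`, that is, one bit. -/
lemma log_numMessages_ge {N : ℕ} {r : ℝ} (hr : 0 ≤ r) :
    (N * r - 1) * Real.log 2 ≤ Real.log (numMessages N r) := by
  have h1 : (1 : ℝ) ≤ numMessages N r := by exact_mod_cast numMessages_pos hr
  have h2 : (2 : ℝ) ^ ((N : ℝ) * r) < numMessages N r + 1 := Nat.lt_floor_add_one _
  have h3 : (2 : ℝ) ^ ((N : ℝ) * r) ≤ 2 * numMessages N r := by linarith
  have h4 := Real.log_le_log (by positivity) h3
  rw [Real.log_rpow two_pos, Real.log_mul two_ne_zero (by linarith)] at h4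
  linarith

/-- If some rate in `J` can absorb the whole of `η`, its reduction alone suffices; otherwise every
truncated rate vanishes. -/
lemma sum_max_sub_le {ι : Type*} (J : Finset ι) {R : ι → ℝ} (hR : ∀ i, 0 ≤ R i) {η : ℝ}
    (hη : 0 ≤ η) : ∑ j ∈ J, max (R j - η) 0 ≤ max (∑ j ∈ J, R j - η) 0 := by
  classical
  by_cases h : ∃ j ∈ J, η ≤ R j
  · obtain ⟨j, hj, hle⟩ := h
    refine le_trans ?_ (le_max_left _ _)
    rw [← Finset.add_sum_erase _ _ hj, ← Finset.add_sum_erase _ _ hj,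
      max_eq_left (by linarith : 0 ≤ R j - η)]
    have : ∑ l ∈ J.erase j, max (R l - η) 0 ≤ ∑ l ∈ J.erase j, R l :=
      Finset.sum_le_sum fun l _ => max_le (by linarith) (hR l)
    linarith
  · push Not at h
    refine le_trans (Finset.sum_nonpos fun j hj => ?_) (le_max_right _ _)
    exact max_le (by linarith [h j hj]) le_rfl

variable {K : ℕ} {X Y : Fin K → Type*} [∀ i, MeasurableSpace (Y i)]

open scoped Classical in
/-- The empirical frequency of the input `x` in a code. -/
noncomputable def Code.inputFreq {M : Fin K → ℕ} {N : ℕ} (c : Code X Y M N) (x : ∀ i, X i) : ℝ :=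
  (∑ w, ∑ t, if c.input w t = x then 1 else 0) / (Fintype.card (∀ i, Fin (M i)) * N)

/-- Makes the right-hand side of the converse linear in the frequencies, ready for a limit with `D`
fixed. -/
lemma Code.sum_inputFreq_mul [Fintype (∀ i, X i)] {M : Fin K → ℕ} {N : ℕ} (c : Code X Y M N)
    (D : (∀ i, X i) → ℝ) :
    ∑ x, c.inputFreq x * D x =
      (∑ w, ∑ t, D (c.input w t)) / (Fintype.card (∀ i, Fin (M i)) * N) := by
  classical
  simp only [Code.inputFreq, div_mul_eq_mul_div, ← Finset.sum_div, Finset.sum_mul]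
  congr 1
  rw [Finset.sum_comm]
  refine Finset.sum_congr rfl fun w _ => ?_
  rw [Finset.sum_comm]
  refine Finset.sum_congr rfl fun t _ => ?_
  simp

lemma Code.inputFreq_mem_stdSimplex [Fintype (∀ i, X i)] {M : Fin K → ℕ} {N : ℕ} (hN : 0 < N)
    (hM : ∀ i, 0 < M i) (c : Code X Y M N) : c.inputFreq ∈ stdSimplex ℝ (∀ i, X i) := by
  have : ∀ i, NeZero (M i) := fun i => ⟨(hM i).ne'⟩
  refine ⟨fun x => ?_, ?_⟩
  · unfold Code.inputFreq
    positivity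
  · have h := c.sum_inputFreq_mul fun _ => 1
    have hW : (0 : ℝ) < Fintype.card (∀ i, Fin (M i)) := Nat.cast_pos.2 Fintype.card_pos
    have hN' : (0 : ℝ) < N := Nat.cast_pos.2 hN
    simp only [mul_one, Finset.sum_const, Finset.card_univ, Fintype.card_fin, nsmul_eq_mul] at h
    rw [h, div_self (by positivity)]

variable [∀ i, MeasurableSpace (X i)]

/-- The back-off from the rates `R` at block length `N` and error probability `e`. -/
noncomputable def backoff (R : Fin K → ℝ) (N : ℕ) (e : ℝ≥0∞) : ℝ :=
  -- Errors cost at most the fraction `K * e` of the total rate; the floors cost at most `K` bits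
  -- and the hypothesis test one more.
  K * e.toReal * ∑ i, R i + (K + 1) / N

lemma backoff_nonneg {R : Fin K → ℝ} (hR : ∀ i, 0 ≤ R i) (N : ℕ) (e : ℝ≥0∞) :
    0 ≤ backoff R N e := by
  have := Finset.sum_nonneg fun i (_ : i ∈ Finset.univ) => hR i
  unfold backoff
  positivity

lemma tendsto_backoff (R : Fin K → ℝ) {e : ℕ → ℝ≥0∞} (he : Tendsto e atTop (𝓝 0)) :
    Tendsto (fun N => backoff R N (e N)) atTop (𝓝 0) := by
  have h1 : Tendsto (fun N => (e N).toReal) atTop (𝓝 0) := by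
    simpa [Function.comp_def] using (ENNReal.tendsto_toReal ENNReal.zero_ne_top).comp he
  have h2 := ((h1.const_mul (K : ℝ)).mul_const (∑ i, R i)).add
    (tendsto_const_div_atTop_nhds_zero_nat ((K : ℝ) + 1))
  simpa [backoff] using h2

/-- The rates of a reliable code, in terms of the left-hand side of `Code.converse`. -/
lemma Code.sum_rate_sub_backoff_le {N : ℕ} (hN : 0 < N) {R : Fin K → ℝ} (hR : ∀ i, 0 ≤ R i)
    (c : Code X Y (fun i => numMessages N (R i)) N) (ch : Kernel (∀ i, X i) (∀ i, Y i))
    (he : K * (c.errorProb ch).toReal ≤ 1) (htop : c.errorProb ch ≠ ∞) (J : Finset (Fin K)) :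
    (∑ j ∈ J, R j - backoff R N (c.errorProb ch)) * (N * Real.log 2) ≤
      (1 - ∑ j ∈ J, (c.userErrorProb ch j).toReal) *
        (∑ j ∈ J, Real.log (numMessages N (R j))) - Real.log 2 := by
  have hlog2 : 0 < Real.log 2 := Real.log_pos one_lt_two
  have hN' : (0 : ℝ) < N := Nat.cast_pos.2 hN
  set e := (c.errorProb ch).toReal with hedef
  set T := ∑ j ∈ J, R j with hT
  have hTall : T ≤ ∑ i, R i :=
    Finset.sum_le_sum_of_subset_of_nonneg (Finset.subset_univ _) fun i _ _ => hR i
  have he0 : 0 ≤ e := ENNReal.toReal_nonneg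
  have hcard : (J.card : ℝ) ≤ K := by
    exact_mod_cast (Finset.card_le_univ J).trans_eq (Fintype.card_fin K)
  have herr : ∑ j ∈ J, (c.userErrorProb ch j).toReal ≤ K * e := by
    calc ∑ j ∈ J, (c.userErrorProb ch j).toReal ≤ ∑ j ∈ J, e :=
          Finset.sum_le_sum fun j _ => ENNReal.toReal_mono htop
            (le_iSup (fun i => c.userErrorProb ch i) j)
      _ ≤ K * e := by
          rw [Finset.sum_const, nsmul_eq_mul]
          exact mul_le_mul_of_nonneg_right hcard he0
  have hlogs : (N * T - K) * Real.log 2 ≤ ∑ j ∈ J, Real.log (numMessages N (R j)) := by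
    calc (N * T - K) * Real.log 2 ≤ (N * T - J.card) * Real.log 2 := by gcongr
      _ = ∑ j ∈ J, (N * R j - 1) * Real.log 2 := by
          rw [← Finset.sum_mul, Finset.sum_sub_distrib, ← Finset.mul_sum]
          simp [hT]
      _ ≤ _ := Finset.sum_le_sum fun j _ => log_numMessages_ge (hR j)
  have hlogs0 : 0 ≤ ∑ j ∈ J, Real.log (numMessages N (R j)) :=
    Finset.sum_nonneg fun j _ => Real.log_natCast_nonneg _
  have h1 : (1 - K * e) * ((N * T - K) * Real.log 2) ≤
      (1 - ∑ j ∈ J, (c.userErrorProb ch j).toReal) *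
        (∑ j ∈ J, Real.log (numMessages N (R j))) :=
    (mul_le_mul_of_nonneg_left hlogs (by linarith)).trans
      (mul_le_mul_of_nonneg_right (by linarith) hlogs0)
  have h2 : (T - backoff R N (c.errorProb ch)) * (N * Real.log 2) =
      (N * T - K * e * (∑ i, R i) * N - (K + 1)) * Real.log 2 := by
    unfold backoff
    field_simp
    ring
  have h3 : (0 : ℝ) ≤ K * e * K := by positivity
  have h4 : K * e * T * N ≤ K * e * (∑ i, R i) * N := by gcongr
  rw [h2]
  nlinarith [mul_nonneg h3 hlog2.le, mul_le_mul_of_nonneg_right h4 hlog2.le]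

/-- Every finite `I j`, `j ∈ J`, is the mean of a causal bound at the atoms of `P`. -/
def HasCausalBounds (P : Measure (∀ i, X i)) (ch : Kernel (∀ i, X i) (∀ i, Y i))
    (J : Finset (Fin K)) (I : Fin K → ℝ≥0∞) : Prop :=
  ∀ j ∈ J, I j ≠ ∞ →
    ∃ (ℓ : (∀ i, X i) → (∀ i, Y i) → ℝ) (q : (∀ i, X i) → Kernel (∀ i, Y i) (Y j)),
      IsCausalBound ch {x | P {x} ≠ 0} J j ℓ q ∧
      ∫ x, ∫ y, ℓ x y ∂(ch x) ∂P = Real.log 2 * (I j).toReal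

lemma ofReal_le_sum_of_toReal_le {ι : Type*} {J : Finset ι} {I : ι → ℝ≥0∞} {r : ℝ}
    (h : (∀ j ∈ J, I j ≠ ∞) → r ≤ ∑ j ∈ J, (I j).toReal) :
    ENNReal.ofReal r ≤ ∑ j ∈ J, I j := by
  by_cases hI : ∀ j ∈ J, I j ≠ ∞
  · rw [← ENNReal.toReal_sum hI] at h
    exact ENNReal.ofReal_le_of_le_toReal (h hI)
  · push Not at hI
    rw [ENNReal.sum_eq_top.2 hI]
    exact le_top

lemma HasCausalBounds.exists_forall {P : Measure (∀ i, X i)}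
    {ch : Kernel (∀ i, X i) (∀ i, Y i)} {J : Finset (Fin K)} {I : Fin K → ℝ≥0∞}
    (h : HasCausalBounds P ch J I) (hI : ∀ j ∈ J, I j ≠ ∞) :
    ∃ (ℓ : Fin K → (∀ i, X i) → (∀ i, Y i) → ℝ)
      (q : ∀ j, (∀ i, X i) → Kernel (∀ i, Y i) (Y j)), ∀ j ∈ J,
      IsCausalBound ch {x | P {x} ≠ 0} J j (ℓ j) (q j) ∧
      ∫ x, ∫ y, ℓ j x y ∂(ch x) ∂P = Real.log 2 * (I j).toReal := by
  have h' : ∀ j, ∃ (ℓ : (∀ i, X i) → (∀ i, Y i) → ℝ)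
      (q : (∀ i, X i) → Kernel (∀ i, Y i) (Y j)), j ∈ J →
      IsCausalBound ch {x | P {x} ≠ 0} J j ℓ q ∧
      ∫ x, ∫ y, ℓ x y ∂(ch x) ∂P = Real.log 2 * (I j).toReal := fun j => by
    by_cases hj : j ∈ J
    · obtain ⟨ℓ, q, hq⟩ := h j hj (hI j hj)
      exact ⟨ℓ, q, fun _ => hq⟩
    · exact ⟨0, 0, fun hj' => absurd hj' hj⟩
  choose ℓ q hq using h'
  exact ⟨ℓ, q, hq⟩

section Region

variable [∀ i, StandardBorelSpace (X i)] [∀ i, Nonempty (X i)]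
  [∀ i, StandardBorelSpace (Y i)] [∀ i, Nonempty (Y i)]

/-- Both kinds of bounds are one statement, for `J = {i}` and for `J = [i, K]`; a bound with an
infinite term is trivial. -/
lemma mem_outerRegion_of_forall_hasCausalBounds {ch : Kernel (∀ i, X i) (∀ i, Y i)}
    {R : Fin K → ℝ} (hR : ∀ i, 0 ≤ R i) (P : Measure (∀ i, X i)) [IsProbabilityMeasure P]
    (h : ∀ (ch' : Kernel (∀ i, X i) (∀ i, Y i)) [IsMarkovKernel ch'], SameMarginals ch ch' →
      ∀ J I, HasCausalBounds P ch' J I → (∀ j ∈ J, I j ≠ ∞) →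
        ∑ j ∈ J, R j ≤ ∑ j ∈ J, (I j).toReal) : R ∈ outerRegion ch := by
  refine ⟨hR, P, inferInstance, fun ch' _ hm => ⟨fun i => ?_, fun i => ?_⟩⟩
  · have := ofReal_le_sum_of_toReal_le (h ch' hm {i} (singleBound P ch') fun j hj hI => by
      obtain rfl := Finset.mem_singleton.1 hj
      exact exists_isCausalBound_singleBound P ch' hI)
    simpa using this
  · exact ofReal_le_sum_of_toReal_le (h ch' hm (Finset.Ici i) (progressiveTerm P ch' i)
      fun j hj hI => exists_isCausalBound_progressiveTerm P ch' (Finset.mem_Ici.1 hj) hI)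

/-- Every rate tuple in the capacity region is, up to the back-off, in the outer region for the
empirical input distribution of the code. -/
theorem Code.max_sub_backoff_mem_outerRegion {N : ℕ} (hN : 0 < N) {R : Fin K → ℝ}
    (hR : ∀ i, 0 ≤ R i) (c : Code X Y (fun i => numMessages N (R i)) N)
    (ch : Kernel (∀ i, X i) (∀ i, Y i)) [IsMarkovKernel ch]
    (he : K * (c.errorProb ch).toReal ≤ 1) (htop : c.errorProb ch ≠ ∞) :
    (fun j => max (R j - backoff R N (c.errorProb ch)) 0) ∈ outerRegion ch := by
  have hlog2 : 0 < Real.log 2 := Real.log_pos one_lt_two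
  have hN' : (0 : ℝ) < N := Nat.cast_pos.2 hN
  have : ∀ i, NeZero (numMessages N (R i)) := fun i => ⟨(numMessages_pos (hR i)).ne'⟩
  set W : ℝ := (Fintype.card (∀ i, Fin (numMessages N (R i))) : ℝ) with hW
  have hWpos : 0 < W := Nat.cast_pos.2 Fintype.card_pos
  -- Uniform weights on pairs (message tuple, time): every input used is an atom, whatever the
  -- alphabets, so the densities apply to the whole code.
  set a : (∀ i, Fin (numMessages N (R i))) × Fin N → ℝ := fun _ => (W * N)⁻¹ with ha
  have hapos : ∀ p, 0 < a p := fun p => by simp only [ha]; positivity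
  set x : (∀ i, Fin (numMessages N (R i))) × Fin N → ∀ i, X i := fun p => c.input p.1 p.2 with hx
  have hP : IsProbabilityMeasure (pointMasses a x) := by
    refine isProbabilityMeasure_pointMasses (fun p => (hapos p).le) ?_ x
    simp only [ha, Finset.sum_const, Finset.card_univ, Fintype.card_prod, Fintype.card_fin,
      nsmul_eq_mul, Nat.cast_mul, ← hW]
    field_simp
  refine mem_outerRegion_of_forall_hasCausalBounds (fun j => le_max_right _ _) (pointMasses a x)
    fun ch' _ hm J I hb hI => ?_
  obtain ⟨ℓ, q, hq⟩ := hb.exists_forall hI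
  have hconv := c.converse (fun i => numMessages_pos (hR i))
    (S := {z | pointMasses a x {z} ≠ 0})
    (fun w t => pointMasses_singleton_ne_zero a x (i := (w, t)) (hapos (w, t))) fun j hj => (hq j hj).1
  have hrate := c.sum_rate_sub_backoff_le hN hR ch he htop J
  simp_rw [c.userErrorProb_congr hm] at hconv
  have hmean : (∑ w, ∑ t, ∑ j ∈ J, ∫ y, ℓ j (c.input w t) y ∂(ch' (c.input w t))) / W =
      N * (Real.log 2 * ∑ j ∈ J, (I j).toReal) := by
    rw [Finset.mul_sum, ← Finset.sum_congr rfl fun j hj => (hq j hj).2]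
    simp_rw [integral_pointMasses (fun p => (hapos p).le)]
    rw [← Fintype.sum_prod_type' (fun w t =>
      ∑ j ∈ J, ∫ y, ℓ j (c.input w t) y ∂(ch' (c.input w t))), Finset.sum_comm (s := J)]
    simp_rw [← Finset.mul_sum, ha]
    rw [← Finset.mul_sum]
    field_simp
    rfl
  rw [hmean] at hconv
  have hmain : ∑ j ∈ J, R j - backoff R N (c.errorProb ch) ≤ ∑ j ∈ J, (I j).toReal := by
    refine le_of_mul_le_mul_right ((hrate.trans hconv).trans_eq ?_) (mul_pos hN' hlog2)
    ring
  exact (sum_max_sub_le J hR (backoff_nonneg hR _ _)).trans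
    (max_le hmain (Finset.sum_nonneg fun j _ => ENNReal.toReal_nonneg))

lemma eventually_error_small {e : ℕ → ℝ≥0∞} (he : Tendsto e atTop (𝓝 0)) :
    ∀ᶠ N in atTop, 0 < N ∧ K * (e N).toReal ≤ 1 ∧ e N ≠ ∞ := by
  have h1 : Tendsto (fun N => K * (e N).toReal) atTop (𝓝 0) := by
    simpa using ((ENNReal.tendsto_toReal ENNReal.zero_ne_top).comp he).const_mul (K : ℝ)
  filter_upwards [eventually_gt_atTop 0, h1.eventually_le_const one_pos,
    he.eventually_lt_const ENNReal.zero_lt_top] with N a b c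
  exact ⟨a, b, c.ne⟩

theorem capacityRegion_subset_closure_outerRegion (ch : Kernel (∀ i, X i) (∀ i, Y i))
    [IsMarkovKernel ch] : capacityRegion ch ⊆ closure (outerRegion ch) := by
  rintro R ⟨hR, c, hc⟩
  refine mem_closure_of_tendsto
    (f := fun N j => max (R j - backoff R N ((c N).errorProb ch)) 0) (b := atTop) ?_ ?_
  · refine tendsto_pi_nhds.2 fun j => ?_
    have h := ((tendsto_backoff R hc).const_sub (R j)).max (tendsto_const_nhds (x := (0 : ℝ)))
    rwa [sub_zero, max_eq_left (hR j)] at h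
  · filter_upwards [eventually_error_small (K := K) hc] with N ⟨h1, h2, h3⟩
    exact (c N).max_sub_backoff_mem_outerRegion h1 hR ch h2 h3

theorem capacityRegion_subset_outerRegion_of_finite [∀ i, Finite (X i)]
    (ch : Kernel (∀ i, X i) (∀ i, Y i)) [IsMarkovKernel ch] :
    capacityRegion ch ⊆ outerRegion ch := by
  classical
  rintro R ⟨hR, c, hc⟩
  have : Fintype (∀ i, X i) := Fintype.ofFinite _
  have hlog2 : 0 < Real.log 2 := Real.log_pos one_lt_two
  -- The shift to `n + 1` avoids block length `0`, where the frequencies do not sum to one.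
  obtain ⟨p, hp, φ, hφ, hlim⟩ := (isCompact_stdSimplex ℝ (∀ i, X i)).tendsto_subseq
    (x := fun n => (c (n + 1)).inputFreq)
    fun n => (c (n + 1)).inputFreq_mem_stdSimplex n.succ_pos fun i => numMessages_pos (hR i)
  have hP : IsProbabilityMeasure (pointMasses p id) :=
    isProbabilityMeasure_pointMasses hp.1 hp.2 id
  refine mem_outerRegion_of_forall_hasCausalBounds hR (pointMasses p id)
    fun ch' _ hm J I hb hI => ?_
  obtain ⟨ℓ, q, hq⟩ := hb.exists_forall hI
  set S : Set (∀ i, X i) := {x | pointMasses p id {x} ≠ 0} with hS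
  have hψ : Tendsto (fun n => φ n + 1) atTop atTop :=
    (tendsto_add_atTop_nat 1).comp hφ.tendsto_atTop
  -- For fixed `δ` the extended densities are finite at every input, and their price on the support
  -- is `-log (1 - δ)` per receiver.
  have key : ∀ δ : ℝ, 0 < δ → δ < 1 → Real.log 2 * ∑ j ∈ J, R j ≤
      Real.log 2 * ∑ j ∈ J, (I j).toReal - J.card * Real.log (1 - δ) := by
    intro δ hδ hδ1
    set ℓ' : Fin K → (∀ i, X i) → (∀ i, Y i) → ℝ := fun j x y =>
      if x ∈ S then ℓ j x y - Real.log (1 - δ) else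
        Real.log (Fintype.card (∀ i, X i)) - Real.log δ with hℓ'
    have hex : ∀ j, ∃ q' : (∀ i, X i) → Kernel (∀ i, Y i) (Y j), j ∈ J →
        IsCausalBound ch' Set.univ J j (ℓ' j) q' := fun j => by
      by_cases hj : j ∈ J
      · obtain ⟨q', hq'⟩ := (hq j hj).1.exists_mixture hj hδ hδ1
        exact ⟨q', fun _ => hq'⟩
      · exact ⟨0, fun h => absurd h hj⟩
    choose q' hq' using hex
    set D : (∀ i, X i) → ℝ := fun x => ∑ j ∈ J, ∫ y, ℓ' j x y ∂(ch' x) with hD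
    have hcode : ∀ᶠ N in atTop, Real.log 2 * (∑ j ∈ J, R j - backoff R N ((c N).errorProb ch)) ≤
        ∑ x, (c N).inputFreq x * D x := by
      filter_upwards [eventually_error_small (K := K) hc] with N ⟨h1, h2, h3⟩
      have hN' : (0 : ℝ) < N := Nat.cast_pos.2 h1
      have hconv := (c N).converse (fun i => numMessages_pos (hR i))
        (fun w t => Set.mem_univ _) hq'
      simp_rw [(c N).userErrorProb_congr hm] at hconv
      have hrate := ((c N).sum_rate_sub_backoff_le h1 hR ch h2 h3 J).trans hconv
      rw [(c N).sum_inputFreq_mul, ← div_div, le_div_iff₀ hN']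
      refine le_trans (le_of_eq ?_) hrate
      ring
    have hleft : Tendsto (fun n => Real.log 2 * (∑ j ∈ J, R j -
        backoff R (φ n + 1) ((c (φ n + 1)).errorProb ch))) atTop
        (𝓝 (Real.log 2 * ∑ j ∈ J, R j)) := by
      have := (((tendsto_backoff R hc).comp hψ).const_sub (∑ j ∈ J, R j)).const_mul (Real.log 2)
      rwa [sub_zero] at this
    have hright : Tendsto (fun n => ∑ x, (c (φ n + 1)).inputFreq x * D x) atTop
        (𝓝 (∑ x, p x * D x)) :=
      tendsto_finsetSum _ fun x _ => ((tendsto_pi_nhds.1 hlim) x).mul_const _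
    have hle := le_of_tendsto_of_tendsto hleft hright (hψ.eventually hcode)
    refine hle.trans (le_of_eq ?_)
    -- The large constant `log n - log δ` off the support, with `n` the number of input tuples, has
    -- limiting weight `p x = 0`.
    have hterm : ∀ x, p x * D x =
        ∑ j ∈ J, (p x * ∫ y, ℓ j x y ∂(ch' x) - p x * Real.log (1 - δ)) := fun x => by
      rcases (hp.1 x).eq_or_lt with h0 | h0
      · simp [← h0]
      · have hxS : x ∈ S := pointMasses_singleton_ne_zero p id h0
        rw [hD, Finset.mul_sum]
        refine Finset.sum_congr rfl fun j hj => ?_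
        simp only [hℓ', hxS, if_true]
        rw [integral_sub ((hq j hj).1.integrable x hxS) (integrable_const _)]
        simp [mul_sub]
    simp_rw [hterm]
    rw [Finset.sum_comm]
    simp_rw [Finset.sum_sub_distrib, ← Finset.sum_mul, hp.2]
    rw [Finset.mul_sum, Finset.sum_const, nsmul_eq_mul, mul_one]
    congr 1
    refine Finset.sum_congr rfl fun j hj => ?_
    rw [← (hq j hj).2, integral_pointMasses hp.1]
    rfl
  have hδlim : Tendsto (fun δ : ℝ => Real.log 2 * ∑ j ∈ J, (I j).toReal -
      J.card * Real.log (1 - δ)) (𝓝[>] 0) (𝓝 (Real.log 2 * ∑ j ∈ J, (I j).toReal)) := by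
    have hcont : ContinuousAt (fun δ : ℝ => Real.log 2 * ∑ j ∈ J, (I j).toReal -
        J.card * Real.log (1 - δ)) 0 := by
      refine continuousAt_const.sub (continuousAt_const.mul (ContinuousAt.log ?_ (by simp)))
      fun_prop
    have := hcont.tendsto.mono_left (nhdsWithin_le_nhds (s := Set.Ioi (0 : ℝ)))
    simpa using this
  refine le_of_mul_le_mul_left (ge_of_tendsto hδlim ?_) hlog2
  filter_upwards [Ioo_mem_nhdsGT (zero_lt_one' ℝ)] with δ hδ
  exact key δ hδ.1 hδ.2

end Region

end CIFC

theorem mainTheorem1 {K : ℕ} {X Y : Fin K → Type*}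
    [∀ i, MeasurableSpace (X i)] [∀ i, StandardBorelSpace (X i)] [∀ i, Nonempty (X i)]
    [∀ i, MeasurableSpace (Y i)] [∀ i, StandardBorelSpace (Y i)] [∀ i, Nonempty (Y i)]
    (ch : Kernel (∀ i, X i) (∀ i, Y i)) [IsMarkovKernel ch] :
    ((∀ i, Finite (X i)) → CIFC.capacityRegion ch ⊆ CIFC.outerRegion ch) ∧
      CIFC.capacityRegion ch ⊆ closure (CIFC.outerRegion ch) :=
  ⟨fun _ => CIFC.capacityRegion_subset_outerRegion_of_finite ch,
    CIFC.capacityRegion_subset_closure_outerRegion ch⟩
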